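/- Let $\Bbbk$ be an algebraically closed field of characteristic $0$, $G$ a finite abelian group and $\Phi\colon G^3\to\Bbbk^*$ a normalized $3$-cocycle; put $\Phi_g(x,y)=\Phi(g,x,y)\Phi(x,y,g)/\Phi(x,g,y)$. Let ${}_{\Bbbk G}^{\Bbbk G}\mathcal{YD}^{\Phi}$ be the braided monoidal category of $G$-graded spaces $V=\bigoplus_{g}V_g$ with operators $e\triangleright$ ($e\in G$) preserving each $V_g$, such that $1\triangleright v=v$ and $e\triangleright(f\triangleright v)=\Phi_g(e,f)\,(ef)\triangleright v$ for $v\in V_g$; for $X\in V_e$, $Y\in V_f$, $Z\in V_g$ the action on tensor products is $h\triangleright(X\otimes Y)=\Phi_h(e,f)(h\triangleright X)\otimes(h\triangleright Y)$, the associativity constraint is $(X\otimes Y)\otimes Z\mapsto\Phi(e,f,g)^{-1}X\otimes(Y\otimes Z)$, and the braiding is $X\otimes Y\mapsto(e\triangleright Y)\otimes X$. For $\Phi=1$ it is the ordinary Yetter–Drinfeld category ${}_{\Bbbk G}^{\Bbbk G}\mathcal{YD}$. A pre-Nichols algebra of a finite-dimensional object $V$ is an $\mathbb N_0$-graded connected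 braided Hopf algebra $\mathcal P(V)$ in this category which is generated by its degree-one component $V$. It is of diagonal type if $V$ has a $G$-homogeneous basis $X_1,\dots,X_N$ whose braiding is $X_i\otimes X_j\mapsto q_{ij}X_j\otimes X_i$ with $q_{ij}\in\Bbbk^*$. If $V=V_1\oplus\cdots\oplus V_\theta$ with nonzero subobjects $V_i$, each concentrated in one $G$-degree $g_i$, then $\mathcal P(V)$ is called graded with respect to this decomposition if it is an $\mathbb N_0^\theta$-graded braided Hopf algebra with $\deg V_i=e_i$, where $e_1,\dots,e_\theta$ is the standard basis of $\mathbb N_0^\theta$. The support group is $G_V=\langle g_1,\dots,g_\theta\rangle$. For a $2$-cochain $J$ with $J(1,x)=J(x,1)=1$, let $\partial J(x,y,z)=J(y,z)J(x,yz)/(J(xy,z)J(x,y))$. The twisting $\mathcal P^J$ of a braided Hopf algebra $\mathcal P$ in ${}_{\Bbbk G}^{\Bbbk G}\mathcal{YD}^{\Phi}$ has the same graded space, unit, counit and antipode. For homogeneous $X,Y$ of degrees $x,y$ its action is $g\triangleright_JX=\frac{J(g,x)}{J(x,g)}\,g\triangleright X$ and its product is $X\circ Y=J(x,y)XY$; in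 its coproduct each term $X_1\otimes X_2$ (with $X_i$ of degree $x_i$) of the coproduct of $\mathcal P$ is multiplied by $J(x_1,x_2)^{-1}$. **Proposition 3.5.** Let $V=V_1\oplus\cdots\oplus V_\theta$ be a direct sum of simple objects of ${}_{\Bbbk G}^{\Bbbk G}\mathcal{YD}^{\Phi}$ and let $\mathcal P(V)$ be a pre-Nichols algebra of $V$ of diagonal type which is graded with respect to this decomposition. Let $G_V\cong\mathbb Z_{m_1}\times\cdots\times\mathbb Z_{m_n}$ be any identification with a product of finite cyclic groups, let $\widehat{G_V}=\mathbb Z_{m_1^2}\times\cdots\times\mathbb Z_{m_n^2}$, and let $\pi\colon\widehat{G_V}\to G_V$ be the epimorphism that maps the $i$-th standard generator to the $i$-th standard generator. Then $\mathcal P(V)$ is twist equivalent to a graded pre-Nichols algebra of diagonal type in the ordinary category ${}_{\Bbbk\widehat{G_V}}^{\Bbbk\widehat{G_V}}\mathcal{YD}$, in the following sense. 1. There are a pre-Nichols algebra $\mathcal Q$ in ${}_{\Bbbk\widehat{G_V}}^{\Bbbk\widehat{G_V}}\mathcal{YD}^{\pi^*\Phi}$, where $\pi^*\Phi(x,y,z)=\Phi(\pi(x),\pi(y),\pi(z))$,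 and a linear isomorphism $f\colon\mathcal P(V)\to\mathcal Q$ of algebras and coalgebras such that $\mathcal Q$ is graded with respect to $f(V_1)\oplus\cdots\oplus f(V_\theta)$, with $\mathbb N_0^\theta$-components the images of those of $\mathcal P(V)$. Moreover $\pi$ maps the $\widehat{G_V}$-degree of every nonzero homogeneous $f(X)$ to the $G$-degree of $X$, and $x\triangleright f(X)=f(\pi(x)\triangleright X)$ for $x\in\widehat{G_V}$. 2. There is a $2$-cochain $J$ on $\widehat{G_V}$, with $J(1,x)=J(x,1)=1$, such that $\partial J=\pi^*\Phi$. 3. The twisting $\mathcal Q^{J^{-1}}$ is a pre-Nichols algebra of diagonal type in ${}_{\Bbbk\widehat{G_V}}^{\Bbbk\widehat{G_V}}\mathcal{YD}$, graded with respect to $f(V_1)\oplus\cdots\oplus f(V_\theta)$, with the same $\mathbb N_0^\theta$-components. The summand $f(V_i)$ is a simple object of this category if and only if $V_i$ is simple as a twisted Yetter–Drinfeld module over $G_V$ (in particular if $\dim V_i=1$). -/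

import Mathlib

universe u

open scoped TensorProduct

namespace TwistedYD

section Cocycles

variable {k : Type*} [Field k] {G : Type*} [CommGroup G]

/-- `Φ` is a normalized 3-cocycle on `G` with values in `kˣ` (trivial coefficients). -/
structure IsNormalizedThreeCocycle (Φ : G → G → G → kˣ) : Prop where
  cocycle : ∀ e f g h : G,
    Φ (e * f) g h * Φ e f (g * h) = Φ e f g * Φ e (f * g) h * Φ f g h
  normalized : ∀ f g : G, Φ f 1 g = 1

/-- The function `Φ_g(x,y) = Φ(g,x,y) Φ(x,y,g) / Φ(x,g,y)`. -/
def slant (Φ : G → G → G → kˣ) (g x y : G) : kˣ :=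
  Φ g x y * Φ x y g / Φ x g y

/-- `J` is a normalized 2-cochain on `G` with values in `kˣ`. -/
structure IsNormalizedTwoCochain (J : G → G → kˣ) : Prop where
  one_left : ∀ x : G, J 1 x = 1
  one_right : ∀ x : G, J x 1 = 1

/-- The coboundary `∂J(x,y,z) = J(y,z) J(x,yz) / (J(xy,z) J(x,y))`. -/
def coboundary (J : G → G → kˣ) (x y z : G) : kˣ :=
  J y z * J x (y * z) / (J (x * y) z * J x y)

/-- The pull-back of a 3-cochain along a group homomorphism. -/
def pullback {F : Type*} [CommGroup F] (ϖ : F →* G) (Φ : G → G → G → kˣ) (x y z : F) : kˣ :=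
  Φ (ϖ x) (ϖ y) (ϖ z)

end Cocycles

section Data

/-- The structure maps of a twisted Yetter-Drinfeld module: the `kG`-comodule structure, given by
the projections `proj g` onto the homogeneous components `V_g` (the coaction is
`v ↦ ∑ g, g ⊗ proj g v`), and the maps `act g = (g ▷ ·)`. The laws are in `IsTwistedYD`. -/
structure YDData (k G V : Type*) [Field k] [CommGroup G] [AddCommGroup V] [Module k V] where
  proj : G → V →ₗ[k] V
  act : G → V →ₗ[k] V

/-- The structure maps of a braided Hopf algebra. The laws are in `IsBraidedHopf`. -/
structure HopfData (k G P : Type*) [Field k] [CommGroup G] [AddCommGroup P] [Module k P]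
    extends YDData k G P where
  mul : P →ₗ[k] P →ₗ[k] P
  one : P
  comul : P →ₗ[k] P ⊗[k] P
  counit : P →ₗ[k] k
  antipode : P →ₗ[k] P

end Data

section Modules

variable {k : Type*} [Field k] {G : Type*} [CommGroup G]
variable {V : Type*} [AddCommGroup V] [Module k V]

/-- `V = ⨁ V_g` is a `G`-graded space and every `V_g` is a projective `G`-representation with
respect to `Φ_g`: an object of the category of twisted Yetter-Drinfeld modules over `(kG, Φ)`.
For `Φ = 1` this is an ordinary Yetter-Drinfeld module over `kG`. -/
structure IsTwistedYD [Fintype G] (Φ : G → G → G → kˣ) (D : YDData k G V) : Prop where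
  proj_self : ∀ g v, D.proj g (D.proj g v) = D.proj g v
  proj_ne : ∀ g h v, g ≠ h → D.proj g (D.proj h v) = 0
  sum_proj : ∀ v, ∑ g, D.proj g v = v
  act_proj : ∀ e g v, D.act e (D.proj g v) = D.proj g (D.act e v)
  act_one : ∀ v, D.act 1 v = v
  act_act : ∀ e f g v,
    D.act e (D.act f (D.proj g v)) = slant Φ g e f • D.act (e * f) (D.proj g v)

/-- `U` is a graded subspace which is stable under the action of the subgroup `F`: a subobject of
`V` when `V` is considered over `F` (for `F = ⊤`, a subobject of `V`). -/
structure IsSubobject (F : Subgroup G) (D : YDData k G V) (U : Submodule k V) : Prop where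
  proj_mem : ∀ g, ∀ u ∈ U, D.proj g u ∈ U
  act_mem : ∀ g ∈ F, ∀ u ∈ U, D.act g u ∈ U

/-- `U` is a simple subobject of `V`, where `V` is considered over `F`. -/
structure IsSimpleSubobject (F : Subgroup G) (D : YDData k G V) (U : Submodule k V) : Prop where
  sub : IsSubobject F D U
  ne_bot : U ≠ ⊥
  eq_bot_or_eq : ∀ U' : Submodule k V, U' ≤ U → IsSubobject F D U' → U' = ⊥ ∨ U' = U

/-- The support group `G_U` of a subobject `U`: the subgroup generated by the degrees of the
nonzero homogeneous components of `U`. -/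
def supportGroup (D : YDData k G V) (U : Submodule k V) : Subgroup G :=
  Subgroup.closure {g | ∃ u ∈ U, D.proj g u ≠ 0}

variable [Fintype G]

/-- The braiding `X ⊗ Y ↦ (e ▷ Y) ⊗ X` for `X` of degree `e`. -/
noncomputable def braiding (D : YDData k G V) : V ⊗[k] V →ₗ[k] V ⊗[k] V :=
  ∑ e, TensorProduct.map (D.act e) (D.proj e) ∘ₗ (TensorProduct.comm k V V).toLinearMap

/-- The subobject `U` is of diagonal type: it has a basis of homogeneous elements on which the
braiding is diagonal. -/
def IsDiagonal (D : YDData k G V) (U : Submodule k V) : Prop :=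
  ∃ (N : ℕ) (X : Module.Basis (Fin N) k U) (q : Fin N → Fin N → kˣ),
    (∀ i, ∃ g, D.proj g (X i : V) = X i) ∧
    ∀ i j, braiding D ((X i : V) ⊗ₜ[k] (X j : V)) = q i j • ((X j : V) ⊗ₜ[k] (X i : V))

/-- The projection of `V ⊗ V` onto its component of degree `g`. -/
noncomputable def tensorProj (D : YDData k G V) (g : G) : V ⊗[k] V →ₗ[k] V ⊗[k] V :=
  ∑ h, TensorProduct.map (D.proj h) (D.proj (h⁻¹ * g))

/-- The action on `V ⊗ V`: `e ▷ (X ⊗ Y) = Φ_e(g,h) (e ▷ X) ⊗ (e ▷ Y)` for `X ∈ V_g`, `Y ∈ V_h`. -/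
noncomputable def tensorAct (Φ : G → G → G → kˣ) (D : YDData k G V) (e : G) :
    V ⊗[k] V →ₗ[k] V ⊗[k] V :=
  ∑ g, ∑ h, slant Φ e g h • TensorProduct.map (D.act e ∘ₗ D.proj g) (D.act e ∘ₗ D.proj h)

/-- The associativity constraint `(X ⊗ Y) ⊗ Z ↦ Φ(e,f,g)⁻¹ X ⊗ (Y ⊗ Z)` for
`X ∈ V_e`, `Y ∈ V_f`, `Z ∈ V_g`. -/
noncomputable def associator (Φ : G → G → G → kˣ) (D : YDData k G V) :
    (V ⊗[k] V) ⊗[k] V →ₗ[k] V ⊗[k] (V ⊗[k] V) :=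
  ∑ e, ∑ f, ∑ g, (Φ e f g)⁻¹ • ((TensorProduct.assoc k V V V).toLinearMap ∘ₗ
    TensorProduct.map (TensorProduct.map (D.proj e) (D.proj f)) (D.proj g))

end Modules

section HopfAlgebras

variable {k : Type*} [Field k] {G : Type*} [CommGroup G]
variable {P : Type*} [AddCommGroup P] [Module k P]

/-- The multiplication of the braided tensor product algebra `P ⊗ P`. For `A, B, C, D` homogeneous
of degrees `a, b, c, d` it is the composite of the constraints
`(A ⊗ B) ⊗ (C ⊗ D) → A ⊗ (B ⊗ (C ⊗ D)) → A ⊗ ((B ⊗ C) ⊗ D) → A ⊗ (((b ▷ C) ⊗ B) ⊗ D)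
→ A ⊗ ((b ▷ C) ⊗ (B ⊗ D)) → (A ⊗ (b ▷ C)) ⊗ (B ⊗ D)`,
with the scalars `Φ(a,b,cd)⁻¹`, `Φ(b,c,d)`, `1`, `Φ(c,b,d)⁻¹`, `Φ(a,c,bd)`, followed by the
multiplication of `P` in both factors. -/
noncomputable def tensorMul [Fintype G] (Φ : G → G → G → kˣ) (H : HopfData k G P) :
    (P ⊗[k] P) ⊗[k] (P ⊗[k] P) →ₗ[k] P ⊗[k] P :=
  ∑ a, ∑ b, ∑ c, ∑ d,
    ((Φ a b (c * d))⁻¹ * Φ b c d * (Φ c b d)⁻¹ * Φ a c (b * d)) •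
      (TensorProduct.map (TensorProduct.lift H.mul) (TensorProduct.lift H.mul) ∘ₗ
        (TensorProduct.tensorTensorTensorComm k P P P P).toLinearMap ∘ₗ
        TensorProduct.map (TensorProduct.map (H.proj a) (H.proj b))
          (TensorProduct.map (H.act b ∘ₗ H.proj c) (H.proj d)))

/-- `H` is a Hopf algebra in the braided monoidal category of twisted Yetter-Drinfeld modules over
`(kG, Φ)`. -/
structure IsBraidedHopf [Fintype G] (Φ : G → G → G → kˣ) (H : HopfData k G P) : Prop where
  yd : IsTwistedYD Φ H.toYDData
  -- the unit and the multiplication are morphisms, and define an algebra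
  proj_one : H.proj 1 H.one = H.one
  act_one : ∀ e, H.act e H.one = H.one
  proj_mul : ∀ g h x y, H.proj (g * h) (H.mul (H.proj g x) (H.proj h y)) =
    H.mul (H.proj g x) (H.proj h y)
  act_mul : ∀ e g h x y, H.act e (H.mul (H.proj g x) (H.proj h y)) =
    slant Φ e g h • H.mul (H.act e (H.proj g x)) (H.act e (H.proj h y))
  one_mul : ∀ x, H.mul H.one x = x
  mul_one : ∀ x, H.mul x H.one = x
  mul_assoc : ∀ e f g x y z,
    H.mul (H.mul (H.proj e x) (H.proj f y)) (H.proj g z) =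
      (Φ e f g)⁻¹ • H.mul (H.proj e x) (H.mul (H.proj f y) (H.proj g z))
  -- the counit and the comultiplication are morphisms, and define a coalgebra
  counit_proj : ∀ x, H.counit (H.proj 1 x) = H.counit x
  counit_act : ∀ e x, H.counit (H.act e x) = H.counit x
  comul_proj : ∀ g x, H.comul (H.proj g x) = tensorProj H.toYDData g (H.comul x)
  comul_act : ∀ e x, H.comul (H.act e x) = tensorAct Φ H.toYDData e (H.comul x)
  counit_comul : ∀ x, TensorProduct.lid k P (H.counit.rTensor P (H.comul x)) = x
  comul_counit : ∀ x, TensorProduct.rid k P (H.counit.lTensor P (H.comul x)) = x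
  coassoc : ∀ x, associator Φ H.toYDData (H.comul.rTensor P (H.comul x)) =
    H.comul.lTensor P (H.comul x)
  -- the counit and the comultiplication are algebra maps
  counit_one : H.counit H.one = 1
  counit_mul : ∀ x y, H.counit (H.mul x y) = H.counit x * H.counit y
  comul_one : H.comul H.one = H.one ⊗ₜ[k] H.one
  comul_mul : ∀ x y, H.comul (H.mul x y) = tensorMul Φ H (H.comul x ⊗ₜ[k] H.comul y)
  -- the antipode is a morphism, and is the convolution inverse of the identity
  antipode_proj : ∀ g x, H.antipode (H.proj g x) = H.proj g (H.antipode x)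
  antipode_act : ∀ e x, H.antipode (H.act e x) = H.act e (H.antipode x)
  antipode_left : ∀ x,
    TensorProduct.lift H.mul (H.antipode.rTensor P (H.comul x)) = H.counit x • H.one
  antipode_right : ∀ x,
    TensorProduct.lift H.mul (H.antipode.lTensor P (H.comul x)) = H.counit x • H.one

/-- `P = ⨁ 𝒢 a` is a grading of the braided Hopf algebra `P` by the additive monoid `A`: the
components are subobjects and all the structure maps are homogeneous of degree zero. -/
structure IsHopfGrading {A : Type*} [AddCommMonoid A] [DecidableEq A] (H : HopfData k G P)
    (𝒢 : A → Submodule k P) : Prop where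
  internal : DirectSum.IsInternal 𝒢
  sub : ∀ a, IsSubobject ⊤ H.toYDData (𝒢 a)
  one_mem : H.one ∈ 𝒢 0
  mul_mem : ∀ a b, ∀ x ∈ 𝒢 a, ∀ y ∈ 𝒢 b, H.mul x y ∈ 𝒢 (a + b)
  counit_eq_zero : ∀ a, a ≠ 0 → ∀ x ∈ 𝒢 a, H.counit x = 0
  comul_mem : ∀ a, ∀ x ∈ 𝒢 a, H.comul x ∈
    Submodule.span k {t | ∃ b c, b + c = a ∧ ∃ y ∈ 𝒢 b, ∃ z ∈ 𝒢 c, t = y ⊗ₜ[k] z}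
  antipode_mem : ∀ a, ∀ x ∈ 𝒢 a, H.antipode x ∈ 𝒢 a

/-- `P` is a pre-Nichols algebra of its finite-dimensional subobject `V`: a connected
`ℕ`-graded braided Hopf algebra which is generated by its component `V` of degree one. -/
structure IsPreNichols [Fintype G] (Φ : G → G → G → kˣ) (H : HopfData k G P)
    (V : Submodule k P) : Prop where
  hopf : IsBraidedHopf Φ H
  finite : Module.Finite k V
  grading : ∃ 𝒩 : ℕ → Submodule k P, IsHopfGrading H 𝒩 ∧ 𝒩 0 = k ∙ H.one ∧ 𝒩 1 = V
  generated : ∀ S : Submodule k P, H.one ∈ S → V ≤ S →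
    (∀ x ∈ S, ∀ y ∈ S, H.mul x y ∈ S) → S = ⊤

/-- `P` is a pre-Nichols algebra of `V = V_1 ⊕ ⋯ ⊕ V_θ`, where each `V_i` is a nonzero subobject
which is concentrated in one `G`-degree, and `𝒢` is an `ℕ^θ`-grading of the braided Hopf algebra
`P` such that `V_i` has degree `e_i`. (Simplicity of the `V_i` is stated separately; a simple
object over a finite abelian group is always concentrated in one degree.) -/
structure IsGradedPreNichols [Fintype G] (Φ : G → G → G → kˣ) (H : HopfData k G P) {θ : ℕ}
    (V : Fin θ → Submodule k P) (𝒢 : (Fin θ → ℕ) → Submodule k P) : Prop where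
  preNichols : IsPreNichols Φ H (⨆ i, V i)
  indep : iSupIndep V
  ne_bot : ∀ i, V i ≠ ⊥
  sub : ∀ i, IsSubobject ⊤ H.toYDData (V i)
  homogeneous : ∀ i, ∃ g, ∀ v ∈ V i, H.proj g v = v
  grading : IsHopfGrading H 𝒢
  deg : ∀ i, V i ≤ 𝒢 (Pi.single i 1)

/-- The twisting `H^J` by a 2-cochain `J`, on the same graded space: for homogeneous `X`, `Y` of
degrees `x`, `y`, the action is `g ▷_J X = J(g,x) / J(x,g) (g ▷ X)`, the multiplication is
`X ∘ Y = J(x,y) X Y`, and a term `X₁ ⊗ X₂` of the comultiplication is multiplied by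
`J(x₁,x₂)⁻¹`. -/
noncomputable def HopfData.twist [Fintype G] (H : HopfData k G P) (J : G → G → kˣ) :
    HopfData k G P where
  proj := H.proj
  act g := ∑ x, (J g x / J x g) • (H.act g ∘ₗ H.proj x)
  mul := ∑ x, ∑ y, J x y • H.mul.compl₁₂ (H.proj x) (H.proj y)
  one := H.one
  comul := ∑ x, ∑ y, (J x y)⁻¹ • (TensorProduct.map (H.proj x) (H.proj y) ∘ₗ H.comul)
  counit := H.counit
  antipode := H.antipode

/-- Braided Hopf algebras over possibly different groups are isomorphic along `f` if the linear
isomorphism `f` is both an algebra morphism and a coalgebra morphism. -/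
structure IsHopfIso {F Q : Type*} [CommGroup F] [AddCommGroup Q] [Module k Q]
    (H : HopfData k G P) (M : HopfData k F Q) (f : P ≃ₗ[k] Q) : Prop where
  map_one : f H.one = M.one
  map_mul : ∀ x y, f (H.mul x y) = M.mul (f x) (f y)
  map_counit : ∀ x, M.counit (f x) = H.counit x
  map_comul : ∀ x,
    M.comul (f x) = TensorProduct.map (f : P →ₗ[k] Q) (f : P →ₗ[k] Q) (H.comul x)

/-- `f` is compatible with the change of the based group along `ϖ : F →* G`: it carries the
`F`-degrees of `Q` to the `G`-degrees of `P`, and `x ∈ F` acts on `Q` as `ϖ x` acts on `P`. -/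
structure IsChangeOfGroup {F Q : Type*} [CommGroup F] [AddCommGroup Q] [Module k Q]
    (ϖ : F →* G) (D : YDData k G P) (E : YDData k F Q) (f : P ≃ₗ[k] Q) : Prop where
  map_degree : ∀ x v, E.proj x (f v) = f v → D.proj (ϖ x) v = v
  map_act : ∀ x v, f (D.act (ϖ x) v) = E.act x (f v)

end HopfAlgebras

section HatGroup

/-- The group `ℤ_{m₁} × ⋯ × ℤ_{mₙ}`, written multiplicatively. -/
abbrev CyclicProduct {n : ℕ} (m : Fin n → ℕ) : Type :=
  ∀ i, Multiplicative (ZMod (m i))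

/-- The group `ℤ_{m₁²} × ⋯ × ℤ_{mₙ²}`. -/
abbrev HatGroup {n : ℕ} (m : Fin n → ℕ) : Type :=
  CyclicProduct fun i => m i ^ 2

/-- The canonical epimorphism sending the `i`-th standard generator to the `i`-th standard
generator. -/
def hatProj {n : ℕ} (m : Fin n → ℕ) : HatGroup m →* CyclicProduct m :=
  MonoidHom.piMap fun i => AddMonoidHom.toMultiplicative
    (ZMod.castHom (dvd_pow_self (m i) two_ne_zero) (ZMod (m i))).toAddMonoidHom

/-- The composite `ℤ_{m₁²} × ⋯ × ℤ_{mₙ²} → ℤ_{m₁} × ⋯ × ℤ_{mₙ} ≃ S ⊆ G` of the canonical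
epimorphism with an identification of a subgroup `S` of `G` with a product of cyclic groups. -/
def hatMap {G : Type*} [CommGroup G] {S : Subgroup G} {n : ℕ} {m : Fin n → ℕ}
    (e : CyclicProduct m ≃* S) : HatGroup m →* G :=
  S.subtype.comp (e.toMonoidHom.comp (hatProj m))

end HatGroup

end TwistedYD

open TwistedYD

/-!
The proof has a cohomological part and a part about Hopf algebras.

*Cohomology.* The degrees of a module of diagonal type act on it by simultaneously diagonalizable
operators, so the scalars `Φ_g(x,y)` and `Φ_g(y,x)` agree when `g`, `x`, `y` are such degrees. Their
quotient is trimultiplicative, hence trivial on the whole support group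
(`IsDiagonal.slant_symm`). It remains to see that a 3-cocycle `Φ` on `A = ℤ_{m₁} × ⋯ × ℤ_{mₙ}`, all
of whose `Φ_g` are symmetric, becomes a coboundary on the covering group `ℤ_{m₁²} × ⋯ × ℤ_{mₙ²}`.
By dimension shifting a 3-cocycle on `B` defines an extension of `B` by the functions `B → kˣ`
modulo constants (`CochainExt`), and a cochain with coboundary `Φ` is the same thing as a
homomorphic section. The section is built one cyclic factor at a time
(`IsTrivializingCover.prod`). A section `s` over the factors treated so far is given, by induction,
and if `g` is the generator of the next factor `ℤ_m`, then a cochain with coboundary `Φ_g`, which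
exists because `Φ_g` is symmetric and `kˣ` is divisible, gives an element `γ` over the lift of `g`
which commutes with `s` (`leftSection_commute_rightElement`). The cochain of `γ` comes from `A`, so
`γ ^ m` is given by the pull-back `ω` of a character of `A`, and `γ ^ (m²) = ω ^ m`. On the covering
group `ω ^ m` is the `m²`-th power of a character, because `gcd(m², mⱼ²)` divides `m mⱼ` for every
other factor (`IsTrivializingCover.divides_cyclic`). Since characters are central in the extension,
dividing by this one corrects `γ` to an element of order dividing `m²`, which extends the section.

*Hopf algebras.* As `P` is generated by `V`, each component of its `ℕ^θ`-grading is concentrated in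
one `G`-degree, which is a product of the degrees of the `V i`. Choosing lifts of these degrees to
the covering group, the same one for equal degrees, defines a grading of `P` by the covering group
that refines the `G`-grading of the support group; with it `P` itself is the algebra `Q`
(`IsGradedPreNichols.regrade`). Twisting by a cochain `K` replaces `Φ` by `Φ · ∂K`
(`IsBraidedHopf.twist`), so `K = J⁻¹` makes the associativity constraint trivial. On an element of
given degree a twisting only rescales the action, so diagonality and simple summands are kept.
-/

namespace TwistedYD

/-! ### Normalized cocycles and the extension attached to a 3-cocycle -/

section Cochains

variable {k : Type*} [Field k] {G : Type*} [CommGroup G] {Φ : G → G → G → kˣ}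

namespace IsNormalizedThreeCocycle

theorem one_left (hΦ : IsNormalizedThreeCocycle Φ) (x y : G) : Φ 1 x y = 1 := by
  have h := hΦ.cocycle 1 1 x y
  simpa [hΦ.normalized] using h

theorem one_right (hΦ : IsNormalizedThreeCocycle Φ) (x y : G) : Φ x y 1 = 1 := by
  have h := hΦ.cocycle x y 1 1
  simpa [hΦ.normalized] using h

theorem pullback {F : Type*} [CommGroup F] (hΦ : IsNormalizedThreeCocycle Φ) (p : F →* G) :
    IsNormalizedThreeCocycle (pullback p Φ) where
  cocycle e f g h := by simpa [TwistedYD.pullback] using hΦ.cocycle (p e) (p f) (p g) (p h)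
  normalized f g := by simpa [TwistedYD.pullback] using hΦ.normalized (p f) (p g)

theorem slant_one_mid (hΦ : IsNormalizedThreeCocycle Φ) (g y : G) : slant Φ g 1 y = 1 := by
  simp [slant, hΦ.one_left, hΦ.normalized]

/-- Each `Φ_g` is a 2-cocycle. -/
theorem slant_cocycle (hΦ : IsNormalizedThreeCocycle Φ) (g x y z : G) :
    slant Φ g x y * slant Φ g (x * y) z = slant Φ g x (y * z) * slant Φ g y z := by
  -- identities between monomials in the abelian group `kˣ` are checked in additive notation
  have h1 := congrArg Additive.ofMul (hΦ.cocycle g x y z)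
  have h2 := congrArg Additive.ofMul (hΦ.cocycle x g y z)
  have h3 := congrArg Additive.ofMul (hΦ.cocycle x y g z)
  have h4 := congrArg Additive.ofMul (hΦ.cocycle x y z g)
  rw [mul_comm x g] at h2
  rw [mul_comm y g] at h3
  rw [mul_comm z g] at h4
  apply Additive.ofMul.injective
  simp only [slant, ofMul_mul, ofMul_div] at *
  linear_combination (norm := abel) -h1 + h2 - h3 + h4

end IsNormalizedThreeCocycle

end Cochains

/-- The group of pairs `(x, α)` with `x ∈ B` and `α : B → kˣ`, `α 1 = 1`, in which
`(x, α) (y, β) = (x y, z ↦ α (y z) β z / (Φ x y z * α y))`. It is an extension of `B` by the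
`B`-module of functions `B → kˣ` modulo constants, and its class corresponds to `Φ`, up to sign,
under the dimension shift `H³(B, kˣ) ≃ H²(B, (B → kˣ) / kˣ)`. The normalization `α 1 = 1` picks one
function from each class modulo constants. -/
@[ext]
structure CochainExt {k : Type*} [Field k] {B : Type*} [CommGroup B] {Φ : B → B → B → kˣ}
    (_hΦ : IsNormalizedThreeCocycle Φ) where
  base : B
  fn : B → kˣ
  fn_one : fn 1 = 1

namespace CochainExt

variable {k : Type*} [Field k] {B : Type*} [CommGroup B] {Φ : B → B → B → kˣ}
  {hΦ : IsNormalizedThreeCocycle Φ}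

attribute [simp] fn_one

instance : Mul (CochainExt hΦ) where
  mul a b := ⟨a.base * b.base,
    fun z => a.fn (b.base * z) * b.fn z / (Φ a.base b.base z * a.fn b.base), by
      simp [hΦ.one_right]⟩

instance : One (CochainExt hΦ) where
  one := ⟨1, 1, rfl⟩

instance : Inv (CochainExt hΦ) where
  inv a := ⟨a.base⁻¹, fun z => Φ a.base⁻¹ a.base (a.base⁻¹ * z) * a.fn a.base⁻¹ /
    (Φ a.base⁻¹ a.base a.base⁻¹ * a.fn (a.base⁻¹ * z)), by simp⟩

@[simp] theorem base_mul (a b : CochainExt hΦ) : (a * b).base = a.base * b.base := rfl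

theorem fn_mul (a b : CochainExt hΦ) (z : B) :
    (a * b).fn z = a.fn (b.base * z) * b.fn z / (Φ a.base b.base z * a.fn b.base) := rfl

@[simp] theorem base_one : (1 : CochainExt hΦ).base = 1 := rfl

@[simp] theorem fn_one' (z : B) : (1 : CochainExt hΦ).fn z = 1 := rfl

instance : Group (CochainExt hΦ) :=
  Group.ofLeftAxioms
    (by
      intro a b c
      ext : 1
      · exact mul_assoc _ _ _
      · funext z
        have h := congrArg Additive.ofMul (hΦ.cocycle a.base b.base c.base z)
        apply Additive.ofMul.injective
        simp only [fn_mul, base_mul, mul_assoc, ofMul_mul, ofMul_div] at *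
        linear_combination (norm := abel) -h)
    (by
      intro a
      ext : 1
      · exact one_mul _
      · funext z
        simp [fn_mul, hΦ.one_left])
    (by
      intro a
      ext : 1
      · exact inv_mul_cancel _
      · funext z
        apply Additive.ofMul.injective
        change Additive.ofMul ((Φ a.base⁻¹ a.base (a.base⁻¹ * (a.base * z)) * a.fn a.base⁻¹ /
          (Φ a.base⁻¹ a.base a.base⁻¹ * a.fn (a.base⁻¹ * (a.base * z)))) * a.fn z /
          (Φ a.base⁻¹ a.base z * (Φ a.base⁻¹ a.base (a.base⁻¹ * a.base) * a.fn a.base⁻¹ /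
          (Φ a.base⁻¹ a.base a.base⁻¹ * a.fn (a.base⁻¹ * a.base))))) = Additive.ofMul 1
        rw [inv_mul_cancel_left, inv_mul_cancel, hΦ.one_right, a.fn_one]
        simp only [ofMul_mul, ofMul_div, ofMul_one]
        abel)

/-- The projection of the extension onto `B`. -/
def baseHom (hΦ : IsNormalizedThreeCocycle Φ) : CochainExt hΦ →* B where
  toFun := base
  map_one' := rfl
  map_mul' _ _ := rfl

@[simp] theorem baseHom_apply (a : CochainExt hΦ) : baseHom hΦ a = a.base := rfl

@[simp] theorem base_pow (a : CochainExt hΦ) (n : ℕ) : (a ^ n).base = a.base ^ n :=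
  map_pow (baseHom hΦ) a n

/-- The characters of `B`, as elements of the kernel of the projection onto `B`. -/
def ofChar (hΦ : IsNormalizedThreeCocycle Φ) : (B →* kˣ) →* CochainExt hΦ where
  toFun μ := ⟨1, μ, map_one μ⟩
  map_one' := rfl
  map_mul' μ ν := by
    ext : 1
    · exact (one_mul _).symm
    · funext z
      simp [fn_mul, hΦ.one_left]

@[simp] theorem base_ofChar (μ : B →* kˣ) : (ofChar hΦ μ).base = 1 := rfl

@[simp] theorem fn_ofChar (μ : B →* kˣ) (z : B) : (ofChar hΦ μ).fn z = μ z := rfl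

/-- Characters only see the constant by which translations change them, so they are central. -/
theorem ofChar_commute (μ : B →* kˣ) (a : CochainExt hΦ) : Commute (ofChar hΦ μ) a := by
  ext : 1
  · exact mul_comm _ _
  · funext z
    simp [fn_mul, hΦ.one_left, hΦ.normalized, div_eq_mul_inv, mul_comm, mul_assoc]

/-- A homomorphic section of the projection onto `B` trivializes `Φ`. -/
theorem exists_coboundary_of_section (S : B →* CochainExt hΦ) (hS : ∀ x, (S x).base = x) :
    ∃ J : B → B → kˣ, IsNormalizedTwoCochain J ∧ coboundary J = Φ := by
  refine ⟨fun x z => (S x).fn z, ⟨fun z => by simp, fun x => by simp⟩, ?_⟩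
  funext x y z
  have h := congrArg (fun a : CochainExt hΦ => a.fn z) (map_mul S x y)
  simp only [fn_mul, hS] at h
  simp only [coboundary, h]
  apply Additive.ofMul.injective
  simp only [ofMul_mul, ofMul_div]
  abel

/-- The elements of the extension whose cochain is invariant under translation by `b`. -/
def periodic (hΦ : IsNormalizedThreeCocycle Φ) (b : B) (hb : ∀ x y z, Φ x y (b * z) = Φ x y z) :
    Submonoid (CochainExt hΦ) where
  carrier := {a | ∀ z, a.fn (b * z) = a.fn z}
  one_mem' _ := rfl
  mul_mem' {a c} ha hc z := by
    change ∀ z, a.fn (b * z) = a.fn z at ha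
    change ∀ z, c.fn (b * z) = c.fn z at hc
    rw [fn_mul, fn_mul, hb, hc, mul_left_comm, ha]

/-- If the degree of `δ` is invisible to `Φ`, the cochain of `δ` is multiplicative along the degrees
of the elements which commute with `δ` and whose cochain is invariant under the degree of `δ`. -/
theorem fn_mul_of_commute {δ ε : CochainExt hΦ} (h : Commute δ ε)
    (hl : ∀ x y, Φ δ.base x y = 1) (hm : ∀ x y, Φ x δ.base y = 1)
    (hε : ∀ z, ε.fn (δ.base * z) = ε.fn z) (z : B) :
    δ.fn (ε.base * z) = δ.fn ε.base * δ.fn z := by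
  have h1 := congrArg (fun a : CochainExt hΦ => a.fn z) h.eq
  have h2 : ε.fn δ.base = 1 := by simpa using hε 1
  simp only [fn_mul, hl, hm, hε, h2, one_mul, div_one] at h1
  rw [div_eq_iff_eq_mul, mul_assoc, mul_comm] at h1
  rw [mul_left_cancel h1, mul_comm]

theorem pow_eq_ofChar {δ : CochainExt hΦ} (hl : ∀ x y, Φ x δ.base y = 1) (ω : B →* kˣ)
    (hω : ∀ z, δ.fn z = ω z) (hωb : ω δ.base = 1) {n : ℕ} (hn : δ.base ^ n = 1) :
    δ ^ n = ofChar hΦ (ω ^ n) := by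
  have h (j : ℕ) (z : B) : (δ ^ j).fn z = ω z ^ j := by
    induction j generalizing z with
    | zero => simp
    | succ j ih =>
      rw [pow_succ, fn_mul, ih, ih, hl, map_mul, hωb, hω, pow_succ]
      simp
  ext : 1
  · rw [base_pow, hn, base_ofChar]
  · funext z
    rw [h, fn_ofChar, MonoidHom.pow_apply]

end CochainExt

/-! ### Symmetric 2-cocycles with values in a divisible group -/

section Divisible

variable {k : Type*} [Field k] [IsAlgClosed k]

theorem exists_units_pow_eq (a : kˣ) {n : ℕ} (hn : n ≠ 0) : ∃ b : kˣ, b ^ n = a := by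
  obtain ⟨z, hz⟩ := IsAlgClosed.exists_pow_nat_eq (a : k) (Nat.pos_of_ne_zero hn)
  have hz0 : z ≠ 0 := by
    rintro rfl
    rw [zero_pow hn] at hz
    exact a.ne_zero hz.symm
  exact ⟨Units.mk0 z hz0, Units.ext (by simpa using hz)⟩

theorem exists_units_zpow_eq (a : kˣ) {n : ℤ} (hn : n ≠ 0) : ∃ b : kˣ, b ^ n = a := by
  obtain ⟨b, hb⟩ := exists_units_pow_eq a (Int.natAbs_ne_zero.2 hn)
  rcases Int.natAbs_eq n with h | h
  · exact ⟨b, by rw [h, zpow_natCast, hb]⟩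
  · exact ⟨b⁻¹, by rw [h, zpow_neg, zpow_natCast, inv_pow, inv_inv, hb]⟩

/-- The group `kˣ` is divisible, hence an injective `ℤ`-module. -/
theorem baer_units : Module.Baer ℤ (Additive kˣ) := by
  let : DivisibleBy (Additive kˣ) ℤ :=
    divisibleByOfSMulRightSurj _ _ fun {n} hn a => by
      obtain ⟨b, hb⟩ := exists_units_zpow_eq a.toMul hn
      exact ⟨Additive.ofMul b, by simp [← ofMul_zpow, hb]⟩
  exact Module.Baer.of_divisible _

end Divisible

/-- The central extension of `A` by `T` defined by a 2-cocycle `c`, on the set `T × A`. -/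
structure CentralExt {T A : Type*} (c : A → A → T) where
  fiber : T
  base : A

namespace CentralExt

variable {T A : Type*} [CommGroup T] [CommGroup A] {c : A → A → T}

/-- The extension is a commutative group when the 2-cocycle is normalized and symmetric. -/
abbrev commGroup (hone : ∀ x, c 1 x = 1) (hsymm : ∀ x y, c x y = c y x)
    (hc : ∀ x y z, c x y * c (x * y) z = c x (y * z) * c y z) : CommGroup (CentralExt c) :=
  letI : Mul (CentralExt c) := ⟨fun a b => ⟨a.fiber * b.fiber * c a.base b.base, a.base * b.base⟩⟩
  letI : One (CentralExt c) := ⟨⟨1, 1⟩⟩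
  letI : Inv (CentralExt c) := ⟨fun a => ⟨a.fiber⁻¹ * (c a.base⁻¹ a.base)⁻¹, a.base⁻¹⟩⟩
  have mul_def (a b : CentralExt c) :
    a * b = ⟨a.fiber * b.fiber * c a.base b.base, a.base * b.base⟩ := rfl
  have one_def : (1 : CentralExt c) = ⟨1, 1⟩ := rfl
  { Group.ofLeftAxioms
      (fun a b d => by
        simp only [mul_def, mk.injEq, mul_assoc, and_true]
        have h := congrArg Additive.ofMul (hc a.base b.base d.base)
        apply Additive.ofMul.injective
        simp only [ofMul_mul] at *
        linear_combination (norm := abel) h)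
      (fun a => by simp [mul_def, one_def, hone])
      (fun a => by
        simp only [mul_def, one_def, mk.injEq, inv_mul_cancel, and_true]
        rw [mul_right_comm _ _ a.fiber, inv_mul_cancel, one_mul, inv_mul_cancel]) with
    mul_comm := fun a b => by
      change (⟨_, _⟩ : CentralExt c) = ⟨_, _⟩
      rw [hsymm, mul_comm a.fiber, mul_comm a.base] }

end CentralExt

/-- Symmetric 2-cocycles with values in the divisible group `kˣ` are coboundaries. -/
theorem exists_coboundary_of_symmetric {k : Type*} [Field k] [IsAlgClosed k] {A : Type*}
    [CommGroup A] (c : A → A → kˣ) (hone : ∀ x, c 1 x = 1) (hsymm : ∀ x y, c x y = c y x)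
    (hc : ∀ x y z, c x y * c (x * y) z = c x (y * z) * c y z) :
    ∃ χ : A → kˣ, ∀ x y, χ x * χ y = χ (x * y) * c x y := by
  let := CentralExt.commGroup hone hsymm hc
  have mul_def (a b : CentralExt c) :
    a * b = ⟨a.fiber * b.fiber * c a.base b.base, a.base * b.base⟩ := rfl
  let ι : kˣ →* CentralExt c :=
    { toFun := fun a => ⟨a, 1⟩
      map_one' := rfl
      map_mul' := fun a b => by simp [mul_def, hone] }
  have hι : Function.Injective ι.toAdditive := fun a b h => congrArg CentralExt.fiber h
  obtain ⟨r, hr⟩ := Module.Baer.extension_property_addMonoidHom (baer_units (k := k))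
    ι.toAdditive hι (AddMonoidHom.id _)
  have hr' (a : kˣ) : (r (Additive.ofMul (ι a))).toMul = a :=
    congrArg Additive.toMul (DFunLike.congr_fun hr (Additive.ofMul a))
  have hmul (a b : CentralExt c) : (r (Additive.ofMul (a * b))).toMul =
      (r (Additive.ofMul a)).toMul * (r (Additive.ofMul b)).toMul := by
    rw [ofMul_mul, map_add, toMul_add]
  refine ⟨fun x => (r (Additive.ofMul (⟨1, x⟩ : CentralExt c))).toMul, fun x y => ?_⟩
  have h : (⟨1, x⟩ * ⟨1, y⟩ : CentralExt c) = ⟨1, x * y⟩ * ι (c x y) := by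
    rw [mul_comm _ (ι _)]
    change (⟨_, _⟩ : CentralExt c) = ⟨_, _⟩
    simp [ι, hone]
  rw [← hmul, h, hmul, hr']

/-! ### Trivializing 3-cocycles on the covering group -/

section ProductSections

variable {k : Type*} [Field k] {A C D E : Type*} [CommGroup A] [CommGroup C] [CommGroup D]
  [CommGroup E] {Φ : A × C → A × C → A × C → kˣ}

/-- A trivialization `J` of the pull-back of `Φ` to the factor `D` of `D × E` defines a section of
the extension `CochainExt` of `D × E` over `D`. -/
def leftSection (hΦ : IsNormalizedThreeCocycle Φ) (p : D →* A) (q : E →* C) (J : D → D → kˣ)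
    (hJ : IsNormalizedTwoCochain J)
    (hJΦ : coboundary J = pullback p (pullback (MonoidHom.inl A C) Φ)) :
    D →* CochainExt (hΦ.pullback (p.prodMap q)) :=
  MonoidHom.mk'
    (fun d => ⟨(d, 1), fun z => J d z.1 * Φ (p d, 1) (p z.1, 1) (1, q z.2), by
      simp [hJ.one_right, hΦ.normalized, ← Prod.one_eq_mk]⟩)
    (by
      intro d d'
      ext : 1
      · simp
      · funext ⟨x, c⟩
        have h1 := congrArg Additive.ofMul (congrFun (congrFun (congrFun hJΦ d) d') x)
        have h2 := congrArg Additive.ofMul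
          (hΦ.cocycle (p d, 1) (p d', 1) (p x, 1) (1, q c))
        apply Additive.ofMul.injective
        simp only [CochainExt.fn_mul, pullback, coboundary, ofMul_mul, ofMul_div,
          Prod.mk_mul_mk, one_mul, mul_one, map_mul, map_one, MonoidHom.inl_apply,
          MonoidHom.coe_prodMap, Prod.map_apply, ← Prod.one_eq_mk, hΦ.one_right] at *
        linear_combination (norm := abel) h2 - h1)

/-- For `g` in the second factor, an element over `g` which commutes with `leftSection`, built from
a cochain `χ` with coboundary `Φ_g`. -/
def rightElement (hΦ : IsNormalizedThreeCocycle Φ) (p : D →* A) (q : E →* C) (g : E)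
    (χ : A × C → kˣ) (hχ : χ 1 = 1) : CochainExt (hΦ.pullback (p.prodMap q)) where
  base := (1, g)
  fn z := (χ (p z.1, q z.2) * Φ (p z.1, 1) (1, q z.2) (1, q g))⁻¹
  fn_one := by simp [← Prod.one_eq_mk, hχ, hΦ.normalized]

theorem leftSection_commute_rightElement (hΦ : IsNormalizedThreeCocycle Φ) (p : D →* A)
    (q : E →* C) (J : D → D → kˣ) (hJ : IsNormalizedTwoCochain J)
    (hJΦ : coboundary J = pullback p (pullback (MonoidHom.inl A C) Φ)) (g : E)
    (χ : A × C → kˣ) (hχ : χ 1 = 1)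
    (hχΦ : ∀ x y, χ x * χ y = χ (x * y) * slant Φ (1, q g) x y) (d : D) :
    Commute (leftSection hΦ p q J hJ hJΦ d) (rightElement hΦ p q g χ hχ) := by
  ext : 1
  · exact mul_comm _ _
  · funext ⟨e, c⟩
    have h1 := congrArg Additive.ofMul (hχΦ (p d, 1) (p e, q c))
    have h2 := congrArg Additive.ofMul
      (hΦ.cocycle (p d, 1) (p e, 1) (1, q c) (1, q g))
    apply Additive.ofMul.injective
    simp only [CochainExt.fn_mul, pullback, slant, ofMul_mul, ofMul_div, ofMul_inv, leftSection,
      rightElement, MonoidHom.mk'_apply,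
      Prod.mk_mul_mk, one_mul, mul_one, map_mul, map_one,
      MonoidHom.coe_prodMap, Prod.map_apply, ← Prod.one_eq_mk, hΦ.normalized,
      hJ.one_right, mul_comm (q g)] at *
    linear_combination (norm := abel) h2 - h1

end ProductSections

section Cyclic

/-- The homomorphism from `ℤ_N` which maps the standard generator to `a`. -/
def cyclicLift {N : ℕ} [NeZero N] {Γ : Type*} [Monoid Γ] (a : Γ) (ha : a ^ N = 1) :
    Multiplicative (ZMod N) →* Γ where
  toFun c := a ^ c.toAdd.val
  map_one' := by simp
  map_mul' c d := by rw [toAdd_mul, ZMod.val_add, ← pow_eq_pow_mod _ ha, pow_add]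

theorem cyclicLift_apply {N : ℕ} [NeZero N] {Γ : Type*} [Monoid Γ] (a : Γ) (ha : a ^ N = 1)
    (c : Multiplicative (ZMod N)) : cyclicLift a ha c = a ^ c.toAdd.val := rfl

theorem eq_generator_pow {N : ℕ} [NeZero N] (c : Multiplicative (ZMod N)) :
    Multiplicative.ofAdd (1 : ZMod N) ^ c.toAdd.val = c := by
  rw [← ofAdd_nsmul, nsmul_one, ZMod.natCast_zmod_val, ofAdd_toAdd]

theorem generator_pow_self (N : ℕ) : Multiplicative.ofAdd (1 : ZMod N) ^ N = 1 := by
  rw [← ofAdd_nsmul, nsmul_one, ZMod.natCast_self, ofAdd_zero]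

/-- The canonical epimorphism `ℤ_{m²} → ℤ_m`. -/
def cyclicProj (m : ℕ) : Multiplicative (ZMod (m ^ 2)) →* Multiplicative (ZMod m) :=
  AddMonoidHom.toMultiplicative
    (ZMod.castHom (dvd_pow_self m two_ne_zero) (ZMod m)).toAddMonoidHom

theorem cyclicProj_generator (m : ℕ) :
    cyclicProj m (Multiplicative.ofAdd 1) = Multiplicative.ofAdd 1 := by
  simp [cyclicProj]

theorem cyclicProj_surjective (m : ℕ) [NeZero m] : Function.Surjective (cyclicProj m) := fun c =>
  ⟨Multiplicative.ofAdd 1 ^ c.toAdd.val, by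
    rw [map_pow, cyclicProj_generator, eq_generator_pow]⟩

end Cyclic

/-- A homomorphism `p : D → A` is a trivializing cover if it has the two properties of the
epimorphisms `ℤ_{m₁²} × ⋯ × ℤ_{mₙ²} → ℤ_{m₁} × ⋯ × ℤ_{mₙ}` which are used to construct
trivializations one cyclic factor at a time. -/
structure IsTrivializingCover (k : Type*) [Field k] {D A : Type*} [CommGroup D] [CommGroup A]
    (p : D →* A) : Prop where
  /-- Every 3-cocycle `Φ` for which all `Φ_g` are symmetric becomes trivial on `D`. -/
  trivializes : ∀ Φ : A → A → A → kˣ, IsNormalizedThreeCocycle Φ →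
    (∀ g x y, slant Φ g x y = slant Φ g y x) →
    ∃ J : D → D → kˣ, IsNormalizedTwoCochain J ∧ coboundary J = pullback p Φ
  /-- For a character `ω` of `A`, the `l`-th power of its pull-back to `D` is the `l²`-th power
  of a character of `D`. -/
  divides : ∀ ω : D →* kˣ, (∀ d, p d = 1 → ω d = 1) → ∀ l : ℕ,
    ∃ μ : D →* kˣ, μ ^ (l ^ 2) = ω ^ l

namespace IsTrivializingCover

variable {k : Type*} [Field k] {D A : Type*} [CommGroup D] [CommGroup A]

theorem of_subsingleton [Subsingleton D] (p : D →* A) : IsTrivializingCover k p where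
  trivializes Φ hΦ _ := by
    refine ⟨fun _ _ => 1, ⟨fun _ => rfl, fun _ => rfl⟩, ?_⟩
    funext x y z
    simp [coboundary, pullback, Subsingleton.elim x 1, hΦ.one_left]
  divides ω _ l := ⟨1, by
    ext d
    simp [Subsingleton.elim d 1]⟩

theorem congr {D' A' : Type*} [CommGroup D'] [CommGroup A'] {p : D →* A} {p' : D' →* A'}
    (h : IsTrivializingCover k p) (e : D' ≃* D) (f : A →* A') (hf : ∀ x, f (p (e x)) = p' x) :
    IsTrivializingCover k p' where
  trivializes Φ hΦ hs := by
    obtain ⟨J, hJ, hJΦ⟩ := h.trivializes (pullback f Φ) (hΦ.pullback f) (fun g x y => by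
      simpa [slant, pullback] using hs (f g) (f x) (f y))
    refine ⟨fun x y => J (e x) (e y), ⟨by simp [hJ.one_left], by simp [hJ.one_right]⟩, ?_⟩
    funext x y z
    simpa [coboundary, pullback, hf] using congrFun (congrFun (congrFun hJΦ (e x)) (e y)) (e z)
  divides ω hω l := by
    obtain ⟨μ, hμ⟩ := h.divides (ω.comp e.symm.toMonoidHom) (fun d hd => hω _ (by
      rw [← hf, MulEquiv.coe_toMonoidHom, e.apply_symm_apply, hd, map_one])) l
    refine ⟨μ.comp e.toMonoidHom, ?_⟩
    ext d
    simpa using congrArg Units.val (DFunLike.congr_fun hμ (e d))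

/-- The divisibility property of `ℤ_{m²} → ℤ_m`: with `g` the generator and `η ^ m = ω g`, the
congruence `l² s ≡ m l` modulo `m²` has a solution because `gcd(l, m)²` divides `m l`, and
`g ↦ η ^ s` is the required character. -/
theorem divides_cyclic [IsAlgClosed k] (m : ℕ) [NeZero m]
    (ω : Multiplicative (ZMod (m ^ 2)) →* kˣ) (hω : ∀ d, cyclicProj m d = 1 → ω d = 1) (l : ℕ) :
    ∃ μ : Multiplicative (ZMod (m ^ 2)) →* kˣ, μ ^ (l ^ 2) = ω ^ l := by
  set g : Multiplicative (ZMod (m ^ 2)) := Multiplicative.ofAdd 1 with hg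
  obtain ⟨η, hη⟩ := exists_units_pow_eq (ω g) (NeZero.ne m)
  have hηm : η ^ ((m : ℤ) ^ 2) = 1 := by
    have : η ^ (m ^ 2) = 1 := by
      rw [pow_two, pow_mul, hη, ← map_pow]
      apply hω
      rw [map_pow, cyclicProj_generator, generator_pow_self]
    exact_mod_cast this
  obtain ⟨s, v, hsv⟩ : ∃ s v : ℤ, (m * l : ℤ) = l ^ 2 * s + m ^ 2 * v := by
    have h1 := Int.gcd_eq_gcd_ab ((l : ℤ) ^ 2) ((m : ℤ) ^ 2)
    have h2 : ((Int.gcd ((l : ℤ) ^ 2) ((m : ℤ) ^ 2) : ℕ) : ℤ) ∣ m * l := by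
      have : Int.gcd ((l : ℤ) ^ 2) ((m : ℤ) ^ 2) = Nat.gcd l m ^ 2 := by
        rw [← Nat.cast_pow, ← Nat.cast_pow, Int.gcd_natCast_natCast, Nat.pow_gcd_pow]
      rw [this, pow_two]
      exact_mod_cast mul_dvd_mul (Nat.gcd_dvd_right l m) (Nat.gcd_dvd_left l m)
    obtain ⟨t, ht⟩ := h2
    exact ⟨Int.gcdA (l ^ 2) (m ^ 2) * t, Int.gcdB (l ^ 2) (m ^ 2) * t, by rw [ht, h1]; ring⟩
  refine ⟨cyclicLift (η ^ s) ?_, ?_⟩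
  · rw [← zpow_natCast, ← zpow_mul, mul_comm, zpow_mul, Nat.cast_pow, hηm, one_zpow]
  · have key : (η ^ s) ^ (l ^ 2) = ω g ^ l := by
      rw [← hη, ← zpow_natCast, ← zpow_mul, ← pow_mul, ← zpow_natCast]
      have : s * ((l ^ 2 : ℕ) : ℤ) = ((m * l : ℕ) : ℤ) + m ^ 2 * (-v) := by
        push_cast
        rw [hsv]
        ring
      rw [this, zpow_add, zpow_mul _ ((m : ℤ) ^ 2), hηm, one_zpow, mul_one]
    refine MonoidHom.ext fun c => ?_
    rw [MonoidHom.pow_apply, MonoidHom.pow_apply, cyclicLift_apply, ← pow_mul, mul_comm, pow_mul,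
      key]
    conv_rhs => rw [← eq_generator_pow c, map_pow]
    rw [← pow_mul, ← pow_mul, mul_comm]

theorem divides_prod [IsAlgClosed k] {p : D →* A} (h : IsTrivializingCover k p) (m : ℕ) [NeZero m]
    (ω : D × Multiplicative (ZMod (m ^ 2)) →* kˣ)
    (hω : ∀ d, p.prodMap (cyclicProj m) d = 1 → ω d = 1) (l : ℕ) :
    ∃ μ : D × Multiplicative (ZMod (m ^ 2)) →* kˣ, μ ^ (l ^ 2) = ω ^ l := by
  obtain ⟨μ, hμ⟩ := h.divides (ω.comp (MonoidHom.inl _ _)) (fun d hd => hω _ (by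
    simp [hd])) l
  obtain ⟨ν, hν⟩ := divides_cyclic m (ω.comp (MonoidHom.inr _ _)) (fun d hd => hω _ (by
    simp [hd])) l
  refine ⟨μ.coprod ν, MonoidHom.ext fun ⟨d, c⟩ => ?_⟩
  have h1 := DFunLike.congr_fun hμ d
  have h2 := DFunLike.congr_fun hν c
  simp only [MonoidHom.pow_apply, MonoidHom.comp_apply, MonoidHom.inl_apply,
    MonoidHom.inr_apply] at h1 h2
  rw [MonoidHom.pow_apply, MonoidHom.pow_apply, MonoidHom.coprod_apply, mul_pow, h1, h2,
    ← mul_pow, ← map_mul, Prod.mk_mul_mk, mul_one, one_mul]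

/-- A trivializing cover stays one when a factor `ℤ_{m²} → ℤ_m` is added. The section over the first
factor is extended by an element `γ` over the generator which commutes with it; `γ ^ m` is given by
a character `ω`, and `γ` is divided by a character whose `m²`-th power is `ω ^ m`. -/
theorem prod [IsAlgClosed k] {p : D →* A} (h : IsTrivializingCover k p) (m : ℕ) [NeZero m] :
    IsTrivializingCover k (p.prodMap (cyclicProj m)) where
  divides := h.divides_prod m
  trivializes Φ hΦ hs := by
    set P := p.prodMap (cyclicProj m) with hP
    obtain ⟨J, hJ, hJΦ⟩ := h.trivializes (pullback (MonoidHom.inl A _) Φ) (hΦ.pullback _)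
      (fun g x y => by simpa [slant, pullback] using hs (g, 1) (x, 1) (y, 1))
    set g : Multiplicative (ZMod (m ^ 2)) := Multiplicative.ofAdd 1 with hg
    have hqg : cyclicProj m g = Multiplicative.ofAdd 1 := cyclicProj_generator m
    obtain ⟨χ, hχΦ⟩ := exists_coboundary_of_symmetric (slant Φ (1, cyclicProj m g))
      (hΦ.slant_one_mid _) (hs _) (hΦ.slant_cocycle _)
    have hχ : χ 1 = 1 := by
      have := hχΦ 1 1
      rwa [hΦ.slant_one_mid, mul_one, mul_one, mul_eq_left] at this
    set s := leftSection hΦ p (cyclicProj m) J hJ hJΦ with hs_def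
    set γ := rightElement hΦ p (cyclicProj m) g χ hχ with hγ
    have hcomm : ∀ d, Commute (s d) γ :=
      leftSection_commute_rightElement hΦ p (cyclicProj m) J hJ hJΦ g χ hχ hχΦ
    set b : D × Multiplicative (ZMod (m ^ 2)) := (1, g ^ m) with hb
    have hPb : P b = 1 := by
      simp [hP, hb, hqg, generator_pow_self]
    have hperiod (b' : D × Multiplicative (ZMod (m ^ 2))) (hb' : P b' = 1) (x y z) :
        pullback P Φ x y (b' * z) = pullback P Φ x y z := by
      simp [pullback, hb']
    -- the cochain of `γ` is pulled back along `P`, and so is that of its powers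
    have hγP (n : ℕ) (b') (hb' : P b' = 1) (z) : (γ ^ n).fn (b' * z) = (γ ^ n).fn z := by
      have hmem : γ ∈ CochainExt.periodic (hΦ.pullback P) b' (hperiod b' hb') := fun z => by
        have h1 : p (b' * z).1 = p z.1 := by
          rw [Prod.fst_mul, map_mul, show p b'.1 = 1 from congrArg Prod.fst hb', one_mul]
        have h2 : cyclicProj m (b' * z).2 = cyclicProj m z.2 := by
          rw [Prod.snd_mul, map_mul, show cyclicProj m b'.2 = 1 from congrArg Prod.snd hb',
            one_mul]
        simp only [hγ, rightElement, h1, h2]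
      exact pow_mem hmem n z
    have hsP (d : D) (z) : (s d).fn (b * z) = (s d).fn z := by
      have h2 : cyclicProj m (g ^ m) = 1 := congrArg Prod.snd hPb
      simp [hs_def, leftSection, hb, h2]
    -- hence `γ ^ m` is multiplicative
    have hcov (y : D × Multiplicative (ZMod (m ^ 2))) : ∃ ε : CochainExt (hΦ.pullback P),
        ε.base = y ∧ Commute (γ ^ m) ε ∧ ∀ z, ε.fn (b * z) = ε.fn z := by
      refine ⟨s y.1 * γ ^ y.2.toAdd.val, ?_, ?_, ?_⟩
      · simp [hs_def, leftSection, hγ, rightElement, hg, eq_generator_pow]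
      · exact ((hcomm _).symm.pow_left _).mul_right (Commute.pow_pow_self _ _ _)
      · exact (CochainExt.periodic (hΦ.pullback P) b (hperiod b hPb)).mul_mem (hsP _)
          (hγP _ b hPb)
    have hbase : (γ ^ m).base = b := by simp [hγ, rightElement, hb]
    have hPbl (x y) : pullback P Φ b x y = 1 := by simp only [pullback, hPb, hΦ.one_left]
    have hPbm (x y) : pullback P Φ x b y = 1 := by simp only [pullback, hPb, hΦ.normalized]
    have hmul (y z) : (γ ^ m).fn (y * z) = (γ ^ m).fn y * (γ ^ m).fn z := by
      obtain ⟨ε, rfl, hε, hεb⟩ := hcov y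
      apply CochainExt.fn_mul_of_commute hε <;> rw [hbase]
      · exact hPbl
      · exact hPbm
      · exact hεb
    let ω : D × Multiplicative (ZMod (m ^ 2)) →* kˣ := MonoidHom.mk' (γ ^ m).fn hmul
    obtain ⟨μ, hμ⟩ := h.divides_prod m ω⁻¹ (fun d hd => by
      have := hγP m d hd 1
      simpa [ω] using this) m
    have hγm : γ ^ (m ^ 2) = CochainExt.ofChar _ (ω ^ m) := by
      have h1 : γ ^ (m ^ 2) = (γ ^ m) ^ m := by
        rw [← pow_mul]
        exact congrArg (γ ^ ·) (pow_two m)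
      rw [h1]
      apply CochainExt.pow_eq_ofChar
      · rw [hbase]
        exact hPbm
      · exact fun z => rfl
      · rw [hbase]
        simpa [ω] using hγP m b hPb 1
      · rw [hbase, hb, Prod.pow_mk, one_pow, ← pow_mul, Prod.mk_eq_one, hg]
        exact ⟨rfl, (congrArg (_ ^ ·) (pow_two m).symm).trans (generator_pow_self _)⟩
    have hγμ : (γ * CochainExt.ofChar _ μ) ^ (m ^ 2) = 1 := by
      rw [((CochainExt.ofChar_commute μ γ).symm).mul_pow, hγm, ← map_pow, hμ, ← map_mul]
      refine (congrArg _ ?_).trans (map_one _)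
      ext z
      simp
    refine CochainExt.exists_coboundary_of_section (hΦ := hΦ.pullback P)
      (s.noncommCoprod (cyclicLift _ hγμ) (fun d c => ?_)) (fun x => ?_)
    · exact ((hcomm d).mul_right (CochainExt.ofChar_commute μ _).symm).pow_right _
    · simp [cyclicLift_apply, hs_def, leftSection, hγ, rightElement, hg, eq_generator_pow]

theorem hatProj [IsAlgClosed k] {n : ℕ} (m : Fin n → ℕ) [∀ i, NeZero (m i)] :
    IsTrivializingCover k (hatProj m) := by
  induction n with
  | zero => exact of_subsingleton _
  | succ n ih =>
    have h := (ih (fun i => m i.succ)).prod (m 0)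
    refine h.congr (D' := HatGroup m) (A' := CyclicProduct m)
      { toFun := fun x => (fun i => x i.succ, x 0)
        invFun := fun x => Fin.cons x.2 x.1
        left_inv := fun x => by
          ext i
          refine Fin.cases ?_ (fun j => ?_) i <;> simp
        right_inv := fun x => by simp
        map_mul' := fun x y => rfl }
      { toFun := fun x => Fin.cons x.2 x.1
        map_one' := by
          funext i
          refine Fin.cases ?_ (fun j => ?_) i <;> rfl
        map_mul' := fun x y => by
          funext i
          refine Fin.cases ?_ (fun j => ?_) i <;> rfl } ?_
    intro x
    funext i
    refine Fin.cases ?_ (fun j => ?_) i <;> rfl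

end IsTrivializingCover

/-! ### The alternating form of a 3-cocycle -/

section Alternating

variable {k : Type*} [Field k] {G : Type*} {Φ : G → G → G → kˣ}

/-- The alternating form `Φ_g(x,y) / Φ_g(y,x)`, the antisymmetrization of `Φ`. -/
def altForm (Φ : G → G → G → kˣ) (g x y : G) : kˣ :=
  slant Φ g x y / slant Φ g y x

theorem altForm_swap (g x y : G) : altForm Φ g y x = (altForm Φ g x y)⁻¹ := by
  simp [altForm]

theorem altForm_rotate (g x y : G) : altForm Φ g x y = altForm Φ x y g := by
  apply Additive.ofMul.injective
  simp only [altForm, slant, ofMul_mul, ofMul_div]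
  abel

variable [CommGroup G]

theorem altForm_mul_right (hΦ : IsNormalizedThreeCocycle Φ) (g x y z : G) :
    altForm Φ g x (y * z) = altForm Φ g x y * altForm Φ g x z := by
  have h1 := congrArg Additive.ofMul (hΦ.slant_cocycle g x y z)
  have h2 := congrArg Additive.ofMul (hΦ.slant_cocycle g y x z)
  have h3 := congrArg Additive.ofMul (hΦ.slant_cocycle g y z x)
  rw [mul_comm y x] at h2
  rw [mul_comm z x] at h3
  apply Additive.ofMul.injective
  simp only [altForm, ofMul_mul, ofMul_div] at *
  linear_combination (norm := abel) -h1 + h2 - h3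

theorem altForm_eq_one_of_closure_right (hΦ : IsNormalizedThreeCocycle Φ) {S : Set G} {g x : G}
    (h : ∀ y ∈ S, altForm Φ g x y = 1) {y : G} (hy : y ∈ Subgroup.closure S) :
    altForm Φ g x y = 1 :=
  let f : G →* kˣ := MonoidHom.mk' (altForm Φ g x) (altForm_mul_right hΦ g x)
  (Subgroup.closure_le f.ker).2 (fun y hy => h y hy) hy

/-- Symmetry of the `Φ_g` can be tested on generators, because `altForm Φ` is trimultiplicative. -/
theorem slant_symm_of_closure (hΦ : IsNormalizedThreeCocycle Φ) {S : Set G}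
    (h : ∀ g ∈ S, ∀ x ∈ S, ∀ y ∈ S, slant Φ g x y = slant Φ g y x) {g x y : G}
    (hg : g ∈ Subgroup.closure S) (hx : x ∈ Subgroup.closure S) (hy : y ∈ Subgroup.closure S) :
    slant Φ g x y = slant Φ g y x := by
  rw [← div_eq_one]
  change altForm Φ g x y = 1
  rw [altForm_rotate]
  refine altForm_eq_one_of_closure_right hΦ (fun g hg => ?_) hg
  rw [← altForm_rotate]
  refine altForm_eq_one_of_closure_right hΦ (fun y hy => ?_) hy
  rw [altForm_swap, inv_eq_one]
  refine altForm_eq_one_of_closure_right hΦ (fun x hx => ?_) hx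
  exact div_eq_one.2 (h g hg y hy x hx)

end Alternating

/-! ### Homogeneous elements -/

section Homogeneous

variable {k : Type*} [Field k] {G : Type*} [CommGroup G]
variable {V : Type*} [AddCommGroup V] [Module k V]

/-- `a` is homogeneous of degree `g`. -/
def YDData.IsHomog (D : YDData k G V) (g : G) (a : V) : Prop :=
  D.proj g a = a ∧ ∀ x, x ≠ g → D.proj x a = 0

theorem YDData.IsHomog.sum_eq [Fintype G] {D : YDData k G V} {g : G} {a : V} (ha : D.IsHomog g a)
    {W : Type*} [AddCommMonoid W] (f : G → V → W) (hf : ∀ x, f x 0 = 0) :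
    ∑ x, f x (D.proj x a) = f g a := by
  rw [Finset.sum_eq_single g, ha.1]
  · intro x _ hx
    rw [ha.2 x hx, hf]
  · simp

theorem YDData.IsHomog.smul {D : YDData k G V} {g : G} {a : V} (ha : D.IsHomog g a) (c : kˣ) :
    D.IsHomog g (c • a) :=
  ⟨by rw [LinearMap.map_smul_of_tower, ha.1], fun x hx => by
    rw [LinearMap.map_smul_of_tower, ha.2 x hx, smul_zero]⟩

variable [Fintype G] {Φ : G → G → G → kˣ} {D : YDData k G V}

theorem IsTwistedYD.isHomog (hD : IsTwistedYD Φ D) {g : G} {a : V} (h : D.proj g a = a) :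
    D.IsHomog g a :=
  ⟨h, fun x hx => by rw [← h, hD.proj_ne x g a hx]⟩

theorem IsTwistedYD.isHomog_proj (hD : IsTwistedYD Φ D) (g : G) (a : V) :
    D.IsHomog g (D.proj g a) :=
  hD.isHomog (hD.proj_self g a)

theorem IsTwistedYD.isHomog_act (hD : IsTwistedYD Φ D) (e : G) {g : G} {a : V}
    (h : D.IsHomog g a) : D.IsHomog g (D.act e a) :=
  hD.isHomog (by rw [← hD.act_proj, h.1])

/-- Linear maps which agree on homogeneous elements are equal. -/
theorem IsTwistedYD.hom_ext (hD : IsTwistedYD Φ D) {W : Type*} [AddCommGroup W] [Module k W]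
    {f₁ f₂ : V →ₗ[k] W} (h : ∀ g a, D.IsHomog g a → f₁ a = f₂ a) : f₁ = f₂ := by
  ext v
  rw [← hD.sum_proj v, map_sum, map_sum]
  exact Finset.sum_congr rfl fun g _ => h g _ (hD.isHomog_proj g v)

theorem IsTwistedYD.tensor_ext (hD : IsTwistedYD Φ D) {W : Type*} [AddCommGroup W] [Module k W]
    {f₁ f₂ : V ⊗[k] V →ₗ[k] W}
    (h : ∀ g a h b, D.IsHomog g a → D.IsHomog h b → f₁ (a ⊗ₜ b) = f₂ (a ⊗ₜ b)) : f₁ = f₂ :=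
  TensorProduct.ext (hD.hom_ext fun g a ha => hD.hom_ext fun x b hb => h g a x b ha hb)

theorem IsTwistedYD.tensor_ext₃ (hD : IsTwistedYD Φ D) {W : Type*} [AddCommGroup W] [Module k W]
    {f₁ f₂ : (V ⊗[k] V) ⊗[k] V →ₗ[k] W}
    (h : ∀ g a h b l c, D.IsHomog g a → D.IsHomog h b → D.IsHomog l c →
      f₁ ((a ⊗ₜ b) ⊗ₜ c) = f₂ ((a ⊗ₜ b) ⊗ₜ c)) : f₁ = f₂ :=
  TensorProduct.ext (hD.tensor_ext fun g a x b ha hb => hD.hom_ext fun l c hc =>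
    h g a x b l c ha hb hc)

theorem IsTwistedYD.tensor_ext₄ (hD : IsTwistedYD Φ D) {W : Type*} [AddCommGroup W] [Module k W]
    {f₁ f₂ : (V ⊗[k] V) ⊗[k] (V ⊗[k] V) →ₗ[k] W}
    (h : ∀ g a h b l c m d, D.IsHomog g a → D.IsHomog h b → D.IsHomog l c → D.IsHomog m d →
      f₁ ((a ⊗ₜ b) ⊗ₜ (c ⊗ₜ d)) = f₂ ((a ⊗ₜ b) ⊗ₜ (c ⊗ₜ d))) : f₁ = f₂ :=
  TensorProduct.ext (hD.tensor_ext fun g a x b ha hb => hD.tensor_ext fun l c m d hc hd =>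
    h g a x b l c m d ha hb hc hd)

theorem braiding_tmul {g : G} {a : V} (ha : D.IsHomog g a) (b : V) :
    braiding D (a ⊗ₜ b) = D.act g b ⊗ₜ a := by
  simp only [braiding, LinearMap.sum_apply, LinearMap.comp_apply, LinearEquiv.coe_coe,
    TensorProduct.comm_tmul, TensorProduct.map_tmul]
  exact ha.sum_eq (fun x y => D.act x b ⊗ₜ[k] y) (by simp)

theorem tensorProj_tmul_of_eq {g h x : G} {a b : V} (ha : D.IsHomog g a) (hb : D.IsHomog h b)
    (hx : g * h = x) : tensorProj D x (a ⊗ₜ b) = a ⊗ₜ b := by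
  simp only [tensorProj, LinearMap.sum_apply, TensorProduct.map_tmul]
  rw [ha.sum_eq (fun y a => a ⊗ₜ[k] D.proj (y⁻¹ * x) b) (by simp), ← hx, inv_mul_cancel_left,
    hb.1]

theorem tensorProj_tmul_of_ne {g h x : G} {a b : V} (ha : D.IsHomog g a) (hb : D.IsHomog h b)
    (hx : g * h ≠ x) : tensorProj D x (a ⊗ₜ b) = 0 := by
  simp only [tensorProj, LinearMap.sum_apply, TensorProduct.map_tmul]
  rw [ha.sum_eq (fun y a => a ⊗ₜ[k] D.proj (y⁻¹ * x) b) (by simp), hb.2, TensorProduct.tmul_zero]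
  rintro rfl
  exact hx (mul_inv_cancel_left _ _)

theorem tensorAct_tmul (Φ : G → G → G → kˣ) (e : G) {g h : G} {a b : V} (ha : D.IsHomog g a)
    (hb : D.IsHomog h b) :
    tensorAct Φ D e (a ⊗ₜ b) = slant Φ e g h • (D.act e a ⊗ₜ[k] D.act e b) := by
  simp only [tensorAct, LinearMap.sum_apply, LinearMap.smul_apply, TensorProduct.map_tmul,
    LinearMap.comp_apply]
  rw [ha.sum_eq (fun x a => ∑ y, slant Φ e x y • (D.act e a ⊗ₜ[k] D.act e (D.proj y b)))
    (by simp)]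
  exact hb.sum_eq (fun y b => slant Φ e g y • (D.act e a ⊗ₜ[k] D.act e b)) (by simp)

theorem associator_tmul (Φ : G → G → G → kˣ) {g h l : G} {a b c : V} (ha : D.IsHomog g a)
    (hb : D.IsHomog h b) (hc : D.IsHomog l c) :
    associator Φ D ((a ⊗ₜ b) ⊗ₜ c) = (Φ g h l)⁻¹ • (a ⊗ₜ[k] (b ⊗ₜ[k] c)) := by
  simp only [associator, LinearMap.sum_apply, LinearMap.smul_apply, TensorProduct.map_tmul,
    LinearMap.comp_apply, LinearEquiv.coe_coe, TensorProduct.assoc_tmul]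
  rw [ha.sum_eq (fun x a => ∑ y, ∑ z, (Φ x y z)⁻¹ •
    (a ⊗ₜ[k] (D.proj y b ⊗ₜ[k] D.proj z c))) (by simp)]
  rw [hb.sum_eq (fun y b => ∑ z, (Φ g y z)⁻¹ • (a ⊗ₜ[k] (b ⊗ₜ[k] D.proj z c))) (by simp)]
  exact hc.sum_eq (fun z c => (Φ g h z)⁻¹ • (a ⊗ₜ[k] (b ⊗ₜ[k] c))) (by simp)

theorem tensorMul_tmul (Φ : G → G → G → kˣ) {H : HopfData k G V} {g h l m : G} {a b c d : V}
    (ha : H.IsHomog g a) (hb : H.IsHomog h b) (hc : H.IsHomog l c) (hd : H.IsHomog m d) :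
    tensorMul Φ H ((a ⊗ₜ b) ⊗ₜ (c ⊗ₜ d)) =
      ((Φ g h (l * m))⁻¹ * Φ h l m * (Φ l h m)⁻¹ * Φ g l (h * m)) •
        (H.mul a (H.act h c) ⊗ₜ[k] H.mul b d) := by
  simp only [tensorMul, LinearMap.sum_apply, LinearMap.smul_apply, TensorProduct.map_tmul,
    LinearMap.comp_apply, LinearEquiv.coe_coe, TensorProduct.tensorTensorTensorComm_tmul,
    TensorProduct.lift.tmul]
  rw [ha.sum_eq (fun x a => ∑ y, ∑ z, ∑ w,
    ((Φ x y (z * w))⁻¹ * Φ y z w * (Φ z y w)⁻¹ * Φ x z (y * w)) •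
      (H.mul a (H.act y (H.proj z c)) ⊗ₜ[k] H.mul (H.proj y b) (H.proj w d))) (by simp)]
  rw [hb.sum_eq (fun y b => ∑ z, ∑ w,
    ((Φ g y (z * w))⁻¹ * Φ y z w * (Φ z y w)⁻¹ * Φ g z (y * w)) •
      (H.mul a (H.act y (H.proj z c)) ⊗ₜ[k] H.mul b (H.proj w d))) (by simp)]
  rw [hc.sum_eq (fun z c => ∑ w,
    ((Φ g h (z * w))⁻¹ * Φ h z w * (Φ z h w)⁻¹ * Φ g z (h * w)) •
      (H.mul a (H.act h c) ⊗ₜ[k] H.mul b (H.proj w d))) (by simp)]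
  exact hd.sum_eq (fun w d =>
    ((Φ g h (l * w))⁻¹ * Φ h l w * (Φ l h w)⁻¹ * Φ g l (h * w)) •
      (H.mul a (H.act h c) ⊗ₜ[k] H.mul b d)) (by simp)

end Homogeneous

/-! ### Twisting a braided Hopf algebra by a 2-cochain -/

section Twist

variable {k : Type*} [Field k] {G : Type*} [CommGroup G] [Fintype G]
variable {P : Type*} [AddCommGroup P] [Module k P]

theorem units_smul_tmul {V W : Type*} [AddCommGroup V] [Module k V] [AddCommGroup W]
    [Module k W] (c : kˣ) (a : V) (b : W) : (c • a) ⊗ₜ[k] b = c • (a ⊗ₜ[k] b) := by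
  simp only [Units.smul_def, TensorProduct.smul_tmul']

theorem tmul_units_smul {V W : Type*} [AddCommGroup V] [Module k V] [AddCommGroup W]
    [Module k W] (c : kˣ) (a : V) (b : W) : a ⊗ₜ[k] (c • b) = c • (a ⊗ₜ[k] b) := by
  simp only [Units.smul_def, TensorProduct.tmul_smul]

/-- The operator on `V ⊗ W` which multiplies `X ⊗ Y` by `c x y`, for `X`, `Y` homogeneous of
degrees `x`, `y`. -/
noncomputable def tensorScale {V W : Type*} [AddCommGroup V] [Module k V] [AddCommGroup W]
    [Module k W] (D : YDData k G V) (E : YDData k G W) (c : G → G → kˣ) :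
    V ⊗[k] W →ₗ[k] V ⊗[k] W :=
  ∑ x, ∑ y, c x y • TensorProduct.map (D.proj x) (E.proj y)

theorem tensorScale_tmul {V W : Type*} [AddCommGroup V] [Module k V] [AddCommGroup W]
    [Module k W] {D : YDData k G V} {E : YDData k G W} (c : G → G → kˣ) {g h : G} {a : V} {b : W}
    (ha : D.IsHomog g a) (hb : E.IsHomog h b) :
    tensorScale D E c (a ⊗ₜ b) = c g h • (a ⊗ₜ[k] b) := by
  simp only [tensorScale, LinearMap.sum_apply, LinearMap.smul_apply, TensorProduct.map_tmul]
  rw [ha.sum_eq (fun x a => ∑ y, c x y • (a ⊗ₜ[k] E.proj y b)) (by simp)]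
  exact hb.sum_eq (fun y b => c g y • (a ⊗ₜ[k] b)) (by simp)

/-- The tensor square of a twisted Yetter-Drinfeld module. -/
noncomputable abbrev tensorSquare (Φ : G → G → G → kˣ) (D : YDData k G P) :
    YDData k G (P ⊗[k] P) where
  proj := tensorProj D
  act := tensorAct Φ D

theorem YDData.IsHomog.tmul {Φ : G → G → G → kˣ} {D : YDData k G P} {g h : G} {a b : P}
    (ha : D.IsHomog g a) (hb : D.IsHomog h b) : (tensorSquare Φ D).IsHomog (g * h) (a ⊗ₜ b) :=
  ⟨tensorProj_tmul_of_eq ha hb rfl, fun _ hx => tensorProj_tmul_of_ne ha hb hx.symm⟩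

variable {H : HopfData k G P} {K : G → G → kˣ}

theorem twist_proj (g : G) : (H.twist K).proj g = H.proj g := rfl

theorem twist_mul {g h : G} {a b : P} (ha : H.IsHomog g a) (hb : H.IsHomog h b) :
    (H.twist K).mul a b = K g h • H.mul a b := by
  simp only [HopfData.twist, LinearMap.sum_apply, LinearMap.smul_apply, LinearMap.compl₁₂_apply]
  rw [ha.sum_eq (fun x a => ∑ y, K x y • H.mul a (H.proj y b)) (by simp)]
  exact hb.sum_eq (fun y b => K g y • H.mul a b) (by simp)

theorem twist_act (e : G) {g : G} {a : P} (ha : H.IsHomog g a) :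
    (H.twist K).act e a = (K e g / K g e) • H.act e a := by
  simp only [HopfData.twist, LinearMap.sum_apply, LinearMap.smul_apply, LinearMap.comp_apply]
  exact ha.sum_eq (fun x a => (K e x / K x e) • H.act e a) (by simp)

theorem twist_comul (x : P) :
    (H.twist K).comul x = tensorScale H.toYDData H.toYDData (fun x y => (K x y)⁻¹) (H.comul x) := by
  simp [HopfData.twist, tensorScale]

theorem YDData.IsHomog.twist {g : G} {a : P} (ha : H.IsHomog g a) :
    (H.twist K).IsHomog g a := ha

namespace IsBraidedHopf

variable {Φ : G → G → G → kˣ}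

theorem isHomog_one (hH : IsBraidedHopf Φ H) : H.IsHomog 1 H.one := hH.yd.isHomog hH.proj_one

theorem isHomog_mul (hH : IsBraidedHopf Φ H) {g h : G} {a b : P} (ha : H.IsHomog g a)
    (hb : H.IsHomog h b) : H.IsHomog (g * h) (H.mul a b) :=
  hH.yd.isHomog (by simpa only [ha.1, hb.1] using hH.proj_mul g h a b)

theorem isHomog_antipode (hH : IsBraidedHopf Φ H) {g : G} {a : P} (ha : H.IsHomog g a) :
    H.IsHomog g (H.antipode a) :=
  hH.yd.isHomog (by rw [← hH.antipode_proj, ha.1])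

theorem counit_eq_zero (hH : IsBraidedHopf Φ H) {g : G} {a : P} (ha : H.IsHomog g a)
    (hg : g ≠ 1) : H.counit a = 0 := by
  rw [← hH.counit_proj, ha.2 1 hg.symm, map_zero]

theorem isHomog_comul (hH : IsBraidedHopf Φ H) {g : G} {a : P} (ha : H.IsHomog g a) :
    (tensorSquare Φ H.toYDData).IsHomog g (H.comul a) :=
  ⟨by rw [← hH.comul_proj, ha.1], fun x hx => by rw [← hH.comul_proj, ha.2 x hx, map_zero]⟩

theorem tensorProj_comul (hH : IsBraidedHopf Φ H) {g : G} {a : P} (ha : H.IsHomog g a) :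
    tensorProj H.toYDData g (H.comul a) = H.comul a := by
  rw [← hH.comul_proj, ha.1]

theorem twist_yd (hH : IsBraidedHopf Φ H) (hK : IsNormalizedTwoCochain K) :
    IsTwistedYD (Φ * coboundary K) (H.twist K).toYDData where
  proj_self := hH.yd.proj_self
  proj_ne := hH.yd.proj_ne
  sum_proj := hH.yd.sum_proj
  act_proj e g v := by
    refine LinearMap.congr_fun (f := (H.twist K).act e ∘ₗ (H.twist K).proj g)
      (g := (H.twist K).proj g ∘ₗ (H.twist K).act e) (hH.yd.hom_ext fun h a ha => ?_) v
    rw [LinearMap.comp_apply, LinearMap.comp_apply, twist_act e ha, LinearMap.map_smul_of_tower,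
      twist_proj]
    rcases eq_or_ne g h with rfl | hne
    · rw [ha.1, twist_act e ha, (hH.yd.isHomog_act e ha).1]
    · rw [ha.2 g hne, (hH.yd.isHomog_act e ha).2 g hne, map_zero, smul_zero]
  act_one v := by
    refine LinearMap.congr_fun (f := (H.twist K).act 1) (g := LinearMap.id)
      (hH.yd.hom_ext fun h a ha => ?_) v
    rw [twist_act 1 ha, hK.one_left, hK.one_right, div_one, one_smul, hH.yd.act_one,
      LinearMap.id_apply]
  act_act e f g v := by
    have ha := hH.yd.isHomog_proj g v
    rw [twist_proj, twist_act f ha, LinearMap.map_smul_of_tower,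
      twist_act e (hH.yd.isHomog_act f ha),
      twist_act _ ha, hH.yd.act_act]
    simp only [smul_smul]
    congr 1
    apply Additive.ofMul.injective
    simp only [slant, coboundary, Pi.mul_apply, ofMul_mul, ofMul_div]
    -- the arguments of the cochains are brought into a common form
    simp only [mul_comm]
    abel

/-- The twisting of a Hopf algebra in the category for `Φ` by a normalized 2-cochain `K` is a Hopf
algebra in the category for `Φ · ∂K`. Each axiom is an identity between operators on tensor powers
of `P`, which is checked on tensors of homogeneous elements. -/
theorem twist (hH : IsBraidedHopf Φ H) (hK : IsNormalizedTwoCochain K) :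
    IsBraidedHopf (Φ * coboundary K) (H.twist K) where
  yd := hH.twist_yd hK
  proj_one := hH.proj_one
  act_one e := by
    change (H.twist K).act e H.one = H.one
    rw [twist_act e hH.isHomog_one, hK.one_left, hK.one_right, div_one, one_smul, hH.act_one]
  proj_mul g h x y := by
    have ha := hH.yd.isHomog_proj g x
    have hb := hH.yd.isHomog_proj h y
    simp only [twist_proj]
    rw [twist_mul ha hb, LinearMap.map_smul_of_tower, (hH.isHomog_mul ha hb).1]
  act_mul e g h x y := by
    have ha := hH.yd.isHomog_proj g x
    have hb := hH.yd.isHomog_proj h y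
    simp only [twist_proj]
    rw [twist_mul ha hb, LinearMap.map_smul_of_tower, twist_act e (hH.isHomog_mul ha hb),
      twist_act e ha,
      twist_act e hb, hH.act_mul, twist_mul ((hH.yd.isHomog_act e ha).smul _)
        ((hH.yd.isHomog_act e hb).smul _)]
    simp only [LinearMap.map_smul_of_tower, LinearMap.smul_apply, smul_smul]
    congr 1
    apply Additive.ofMul.injective
    simp only [slant, coboundary, Pi.mul_apply, ofMul_mul, ofMul_div]
    simp only [mul_comm]
    abel
  one_mul x := by
    refine LinearMap.congr_fun (f := (H.twist K).mul H.one) (g := LinearMap.id)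
      (hH.yd.hom_ext fun h a ha => ?_) x
    rw [twist_mul hH.isHomog_one ha, hK.one_left, one_smul, hH.one_mul, LinearMap.id_apply]
  mul_one x := by
    refine LinearMap.congr_fun (f := (H.twist K).mul.flip H.one) (g := LinearMap.id)
      (hH.yd.hom_ext fun h a ha => ?_) x
    rw [LinearMap.flip_apply, twist_mul ha hH.isHomog_one, hK.one_right, one_smul, hH.mul_one,
      LinearMap.id_apply]
  mul_assoc e f g x y z := by
    have ha := hH.yd.isHomog_proj e x
    have hb := hH.yd.isHomog_proj f y
    have hc := hH.yd.isHomog_proj g z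
    simp only [twist_proj]
    rw [twist_mul ha hb, twist_mul ((hH.isHomog_mul ha hb).smul _) hc, twist_mul hb hc,
      twist_mul ha ((hH.isHomog_mul hb hc).smul _)]
    simp only [LinearMap.map_smul_of_tower, LinearMap.smul_apply, hH.mul_assoc, smul_smul]
    congr 1
    apply Additive.ofMul.injective
    simp only [coboundary, Pi.mul_apply, ofMul_mul, ofMul_div, ofMul_inv]
    abel
  counit_proj := hH.counit_proj
  counit_act e x := by
    refine LinearMap.congr_fun (f := H.counit ∘ₗ (H.twist K).act e) (g := H.counit)
      (hH.yd.hom_ext fun h a ha => ?_) x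
    rw [LinearMap.comp_apply, twist_act e ha, LinearMap.map_smul_of_tower, hH.counit_act]
    rcases eq_or_ne h 1 with rfl | hne
    · rw [hK.one_left, hK.one_right, div_one, one_smul]
    · rw [hH.counit_eq_zero ha hne, smul_zero]
  comul_proj g x := by
    rw [twist_proj, twist_comul, twist_comul, hH.comul_proj]
    refine LinearMap.congr_fun (f := tensorScale _ _ _ ∘ₗ tensorProj H.toYDData g)
      (g := tensorProj (H.twist K).toYDData g ∘ₗ tensorScale _ _ _)
      (hH.yd.tensor_ext fun p a q b ha hb => ?_) (H.comul x)
    rw [LinearMap.comp_apply, LinearMap.comp_apply, tensorScale_tmul _ ha hb,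
      LinearMap.map_smul_of_tower]
    by_cases h : p * q = g
    · rw [tensorProj_tmul_of_eq ha hb h, tensorProj_tmul_of_eq ha.twist hb.twist h,
        tensorScale_tmul _ ha hb]
    · rw [tensorProj_tmul_of_ne ha hb h, tensorProj_tmul_of_ne ha.twist hb.twist h, map_zero,
        smul_zero]
  comul_act e x := by
    refine LinearMap.congr_fun (f := (H.twist K).comul ∘ₗ (H.twist K).act e)
      (g := tensorAct (Φ * coboundary K) (H.twist K).toYDData e ∘ₗ (H.twist K).comul)
      (hH.yd.hom_ext fun g a ha => ?_) x
    rw [LinearMap.comp_apply, LinearMap.comp_apply, twist_act e ha, LinearMap.map_smul_of_tower,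
      twist_comul, twist_comul, hH.comul_act, ← hH.tensorProj_comul ha]
    refine LinearMap.congr_fun
      (f := (K e g / K g e) • (tensorScale _ _ _ ∘ₗ tensorAct Φ H.toYDData e ∘ₗ
        tensorProj H.toYDData g))
      (g := tensorAct (Φ * coboundary K) (H.twist K).toYDData e ∘ₗ tensorScale _ _ _ ∘ₗ
        tensorProj H.toYDData g)
      (hH.yd.tensor_ext fun p b q c hb hc => ?_) (H.comul a)
    simp only [LinearMap.comp_apply, LinearMap.smul_apply]
    by_cases h : p * q = g
    · rw [tensorProj_tmul_of_eq hb hc h, tensorAct_tmul _ _ hb hc, LinearMap.map_smul_of_tower,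
        tensorScale_tmul _ (hH.yd.isHomog_act e hb) (hH.yd.isHomog_act e hc),
        tensorScale_tmul _ hb hc, LinearMap.map_smul_of_tower, tensorAct_tmul _ _ hb.twist hc.twist,
        twist_act e hb, twist_act e hc]
      subst h
      simp only [tmul_units_smul, units_smul_tmul, smul_smul]
      congr 1
      apply Additive.ofMul.injective
      simp only [slant, coboundary, Pi.mul_apply, ofMul_mul, ofMul_div, ofMul_inv]
      simp only [mul_comm]
      abel
    · rw [tensorProj_tmul_of_ne hb hc h]
      simp
  counit_comul x := by
    rw [twist_comul]
    conv_rhs => rw [← hH.counit_comul x]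
    refine congrArg _ (LinearMap.congr_fun (f := H.counit.rTensor P ∘ₗ tensorScale _ _ _)
      (g := H.counit.rTensor P) (hH.yd.tensor_ext fun p a q b ha hb => ?_) (H.comul x))
    rw [LinearMap.comp_apply, tensorScale_tmul _ ha hb, LinearMap.map_smul_of_tower]
    rcases eq_or_ne p 1 with rfl | hne
    · rw [hK.one_left, inv_one, one_smul]
    · rw [LinearMap.rTensor_tmul, hH.counit_eq_zero ha hne, TensorProduct.zero_tmul, smul_zero]
  comul_counit x := by
    rw [twist_comul]
    conv_rhs => rw [← hH.comul_counit x]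
    refine congrArg _ (LinearMap.congr_fun (f := H.counit.lTensor P ∘ₗ tensorScale _ _ _)
      (g := H.counit.lTensor P) (hH.yd.tensor_ext fun p a q b ha hb => ?_) (H.comul x))
    rw [LinearMap.comp_apply, tensorScale_tmul _ ha hb, LinearMap.map_smul_of_tower]
    rcases eq_or_ne q 1 with rfl | hne
    · rw [hK.one_right, inv_one, one_smul]
    · rw [LinearMap.lTensor_tmul, hH.counit_eq_zero hb hne, TensorProduct.tmul_zero, smul_zero]
  coassoc x := by
    set D := H.toYDData
    set c : G → G → kˣ := fun x y => (K x y)⁻¹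
    -- both sides are scalings of the two iterated coproducts of `H`
    have hl : (H.twist K).comul.rTensor P ((H.twist K).comul x) =
        (tensorScale D D c).rTensor P (tensorScale (tensorSquare Φ D) D c
          (H.comul.rTensor P (H.comul x))) := by
      rw [twist_comul]
      refine LinearMap.congr_fun (f := (H.twist K).comul.rTensor P ∘ₗ tensorScale D D c)
        (g := (tensorScale D D c).rTensor P ∘ₗ tensorScale (tensorSquare Φ D) D c ∘ₗ
          H.comul.rTensor P) (hH.yd.tensor_ext fun p a q b ha hb => ?_) (H.comul x)
      simp only [LinearMap.comp_apply]
      rw [tensorScale_tmul _ ha hb, LinearMap.rTensor_tmul,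
        tensorScale_tmul _ (hH.isHomog_comul ha) hb, LinearMap.map_smul_of_tower,
        LinearMap.map_smul_of_tower, LinearMap.rTensor_tmul, LinearMap.rTensor_tmul, twist_comul]
    have hr : (H.twist K).comul.lTensor P ((H.twist K).comul x) =
        (tensorScale D D c).lTensor P (tensorScale D (tensorSquare Φ D) c
          (H.comul.lTensor P (H.comul x))) := by
      rw [twist_comul]
      refine LinearMap.congr_fun (f := (H.twist K).comul.lTensor P ∘ₗ tensorScale D D c)
        (g := (tensorScale D D c).lTensor P ∘ₗ tensorScale D (tensorSquare Φ D) c ∘ₗ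
          H.comul.lTensor P) (hH.yd.tensor_ext fun p a q b ha hb => ?_) (H.comul x)
      simp only [LinearMap.comp_apply]
      rw [tensorScale_tmul _ ha hb, LinearMap.lTensor_tmul,
        tensorScale_tmul _ ha (hH.isHomog_comul hb), LinearMap.map_smul_of_tower,
        LinearMap.map_smul_of_tower, LinearMap.lTensor_tmul, LinearMap.lTensor_tmul, twist_comul]
    rw [hl, hr, ← hH.coassoc]
    refine LinearMap.congr_fun
      (f := associator (Φ * coboundary K) (H.twist K).toYDData ∘ₗ (tensorScale D D c).rTensor P ∘ₗ
        tensorScale (tensorSquare Φ D) D c)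
      (g := (tensorScale D D c).lTensor P ∘ₗ tensorScale D (tensorSquare Φ D) c ∘ₗ
        associator Φ D) (hH.yd.tensor_ext₃ fun p a q b r d ha hb hd => ?_) _
    simp only [LinearMap.comp_apply]
    rw [tensorScale_tmul _ (ha.tmul hb) hd, LinearMap.map_smul_of_tower,
      LinearMap.map_smul_of_tower, LinearMap.rTensor_tmul, tensorScale_tmul _ ha hb,
      units_smul_tmul, LinearMap.map_smul_of_tower,
      associator_tmul _ ha.twist hb.twist hd.twist, associator_tmul _ ha hb hd,
      LinearMap.map_smul_of_tower, LinearMap.map_smul_of_tower,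
      tensorScale_tmul _ ha (hb.tmul hd), LinearMap.map_smul_of_tower, LinearMap.lTensor_tmul,
      tensorScale_tmul _ hb hd, tmul_units_smul]
    simp only [smul_smul]
    congr 1
    apply Additive.ofMul.injective
    simp only [c, coboundary, Pi.mul_apply, ofMul_mul, ofMul_div, ofMul_inv]
    abel
  counit_one := hH.counit_one
  counit_mul x y := by
    refine LinearMap.congr_fun (LinearMap.congr_fun (f := (H.twist K).mul.compr₂ H.counit)
      (g := (LinearMap.mul k k).compl₁₂ H.counit H.counit)
      (hH.yd.hom_ext fun g a ha => hH.yd.hom_ext fun h b hb => ?_) x) y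
    rw [LinearMap.compr₂_apply, LinearMap.compl₁₂_apply, LinearMap.mul_apply', twist_mul ha hb,
      LinearMap.map_smul_of_tower, hH.counit_mul]
    rcases eq_or_ne g 1 with rfl | hne
    · rw [hK.one_left, one_smul]
    · rw [hH.counit_eq_zero ha hne, zero_mul, smul_zero]
  comul_one := by
    change (H.twist K).comul H.one = H.one ⊗ₜ[k] H.one
    rw [twist_comul, hH.comul_one, tensorScale_tmul _ hH.isHomog_one hH.isHomog_one, hK.one_left,
      inv_one, one_smul]
  comul_mul x y := by
    set D := H.toYDData
    set S := tensorScale D D fun x y => (K x y)⁻¹ with hS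
    refine LinearMap.congr_fun (LinearMap.congr_fun
      (f := (H.twist K).mul.compr₂ (H.twist K).comul)
      (g := ((TensorProduct.mk k _ _).compl₁₂ (H.twist K).comul (H.twist K).comul).compr₂
        (tensorMul (Φ * coboundary K) (H.twist K)))
      (hH.yd.hom_ext fun g a ha => hH.yd.hom_ext fun h b hb => ?_) x) y
    rw [LinearMap.compr₂_apply, LinearMap.compr₂_apply, LinearMap.compl₁₂_apply,
      TensorProduct.mk_apply, twist_mul ha hb, LinearMap.map_smul_of_tower, twist_comul,
      twist_comul, twist_comul, hH.comul_mul, ← hH.tensorProj_comul ha, ← hH.tensorProj_comul hb]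
    refine LinearMap.congr_fun
      (f := K g h • (S ∘ₗ tensorMul Φ H ∘ₗ TensorProduct.map (tensorProj D g) (tensorProj D h)))
      (g := tensorMul (Φ * coboundary K) (H.twist K) ∘ₗ TensorProduct.map S S ∘ₗ
        TensorProduct.map (tensorProj D g) (tensorProj D h))
      (hH.yd.tensor_ext₄ fun p a q b r c s d ha hb hc hd => ?_) (H.comul a ⊗ₜ[k] H.comul b)
    simp only [LinearMap.comp_apply, LinearMap.smul_apply, TensorProduct.map_tmul]
    by_cases h₁ : p * q = g
    · by_cases h₂ : r * s = h
      · rw [tensorProj_tmul_of_eq ha hb h₁, tensorProj_tmul_of_eq hc hd h₂,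
          tensorMul_tmul Φ ha hb hc hd, LinearMap.map_smul_of_tower, hS,
          tensorScale_tmul _ (hH.isHomog_mul ha (hH.yd.isHomog_act q hc)) (hH.isHomog_mul hb hd),
          tensorScale_tmul _ ha hb, tensorScale_tmul _ hc hd, units_smul_tmul,
          tmul_units_smul, LinearMap.map_smul_of_tower, LinearMap.map_smul_of_tower,
          tensorMul_tmul _ ha.twist hb.twist hc.twist hd.twist, twist_act q hc, twist_mul hb hd,
          twist_mul ha ((hH.yd.isHomog_act q hc).smul _), LinearMap.map_smul_of_tower]
        subst h₁ h₂
        simp only [tmul_units_smul, units_smul_tmul, smul_smul]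
        congr 1
        apply Additive.ofMul.injective
        simp only [coboundary, Pi.mul_apply, ofMul_mul, ofMul_div, ofMul_inv]
        simp only [mul_comm, mul_left_comm]
        abel
      · rw [tensorProj_tmul_of_ne hc hd h₂]
        simp
    · rw [tensorProj_tmul_of_ne ha hb h₁]
      simp
  antipode_proj := hH.antipode_proj
  antipode_act e x := by
    refine LinearMap.congr_fun (f := H.antipode ∘ₗ (H.twist K).act e)
      (g := (H.twist K).act e ∘ₗ H.antipode) (hH.yd.hom_ext fun h a ha => ?_) x
    rw [LinearMap.comp_apply, LinearMap.comp_apply, twist_act e ha, LinearMap.map_smul_of_tower,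
      hH.antipode_act, twist_act e (hH.isHomog_antipode ha)]
  antipode_left x := by
    refine Eq.trans ?_ (hH.antipode_left x)
    rw [twist_comul]
    refine LinearMap.congr_fun
      (f := TensorProduct.lift (H.twist K).mul ∘ₗ H.antipode.rTensor P ∘ₗ tensorScale _ _ _)
      (g := TensorProduct.lift H.mul ∘ₗ H.antipode.rTensor P)
      (hH.yd.tensor_ext fun p a q b ha hb => ?_) (H.comul x)
    simp only [LinearMap.comp_apply]
    rw [tensorScale_tmul _ ha hb, LinearMap.map_smul_of_tower, LinearMap.map_smul_of_tower,
      LinearMap.rTensor_tmul,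
      TensorProduct.lift.tmul, twist_mul (hH.isHomog_antipode ha) hb, smul_smul, inv_mul_cancel,
      one_smul, TensorProduct.lift.tmul]
  antipode_right x := by
    refine Eq.trans ?_ (hH.antipode_right x)
    rw [twist_comul]
    refine LinearMap.congr_fun
      (f := TensorProduct.lift (H.twist K).mul ∘ₗ H.antipode.lTensor P ∘ₗ tensorScale _ _ _)
      (g := TensorProduct.lift H.mul ∘ₗ H.antipode.lTensor P)
      (hH.yd.tensor_ext fun p a q b ha hb => ?_) (H.comul x)
    simp only [LinearMap.comp_apply]
    rw [tensorScale_tmul _ ha hb, LinearMap.map_smul_of_tower, LinearMap.map_smul_of_tower,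
      LinearMap.lTensor_tmul,
      TensorProduct.lift.tmul, twist_mul ha (hH.isHomog_antipode hb), smul_smul, inv_mul_cancel,
      one_smul, TensorProduct.lift.tmul]

end IsBraidedHopf

end Twist

/-! ### Change of the group -/

section Coarsening

variable {k : Type*} [Field k] {P : Type*} [AddCommGroup P] [Module k P]
variable {A : Type*} [DecidableEq A] {𝒢 : A → Submodule k P}

theorem hom_ext_of_isInternal (h : DirectSum.IsInternal 𝒢) {W : Type*} [AddCommGroup W]
    [Module k W] {f₁ f₂ : P →ₗ[k] W} (hf : ∀ d, ∀ v ∈ 𝒢 d, f₁ v = f₂ v) : f₁ = f₂ := by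
  have : (⊤ : Submodule k P) ≤ LinearMap.eqLocus f₁ f₂ := by
    rw [← h.submodule_iSup_eq_top]
    exact iSup_le hf
  ext v
  exact this trivial

open Classical in
/-- For a grading `P = ⨁ 𝒢 d` and a map `deg : A → F`, the projection of `P` onto the sum of the
components `𝒢 d` with `deg d = x`. -/
noncomputable def coarseProj (h : DirectSum.IsInternal 𝒢) {F : Type*} (deg : A → F) (x : F) :
    P →ₗ[k] P :=
  (DirectSum.toModule k A P fun d => if deg d = x then (𝒢 d).subtype else 0) ∘ₗ
    (LinearEquiv.ofBijective (DirectSum.coeLinearMap 𝒢) h).symm.toLinearMap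

open Classical in
theorem coarseProj_apply (h : DirectSum.IsInternal 𝒢) {F : Type*} (deg : A → F) (x : F) {d : A}
    {v : P} (hv : v ∈ 𝒢 d) : coarseProj h deg x v = if deg d = x then v else 0 := by
  have : (LinearEquiv.ofBijective (DirectSum.coeLinearMap 𝒢) h).symm v =
      DirectSum.lof k A (fun d => 𝒢 d) d ⟨v, hv⟩ := by
    rw [LinearEquiv.symm_apply_eq]
    exact (DirectSum.coeLinearMap_lof 𝒢 d ⟨v, hv⟩).symm
  rw [coarseProj, LinearMap.comp_apply, LinearEquiv.coe_coe, this, DirectSum.toModule_lof]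
  split_ifs <;> rfl

theorem coarseProj_of_eq (h : DirectSum.IsInternal 𝒢) {F : Type*} {deg : A → F} {x : F} {d : A}
    {v : P} (hv : v ∈ 𝒢 d) (hx : deg d = x) : coarseProj h deg x v = v := by
  rw [coarseProj_apply h deg x hv, if_pos hx]

theorem coarseProj_of_ne (h : DirectSum.IsInternal 𝒢) {F : Type*} {deg : A → F} {x : F} {d : A}
    {v : P} (hv : v ∈ 𝒢 d) (hx : deg d ≠ x) : coarseProj h deg x v = 0 := by
  rw [coarseProj_apply h deg x hv, if_neg hx]

/-- Subspaces of the components of a grading which together span everything are the whole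
components. -/
theorem le_of_iSup_inf_eq_top (h : DirectSum.IsInternal 𝒢) {W : A → Submodule k P}
    (hW : ⨆ d, 𝒢 d ⊓ W d = ⊤) (d : A) : 𝒢 d ≤ W d := by
  have : (⊤ : Submodule k P) ≤ (W d).comap (coarseProj h id d) := by
    rw [← hW]
    refine iSup_le fun a v hv => ?_
    rw [Submodule.mem_comap]
    by_cases ha : a = d
    · subst ha
      rw [coarseProj_of_eq h hv.1 (deg := id) (x := a) rfl]
      exact hv.2
    · rw [coarseProj_of_ne h hv.1 ha]
      exact zero_mem _
  intro v hv
  rw [← coarseProj_of_eq h (deg := id) hv rfl]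
  exact this trivial

end Coarsening

section Regrade

variable {k : Type*} [Field k] {G F : Type*} [CommGroup G] [CommGroup F]
variable {P : Type*} [AddCommGroup P] [Module k P]

/-- The change of the group of a braided Hopf algebra along `ϖ : F →* G`: the same algebra and
coalgebra, with a given `F`-grading, on which `x ∈ F` acts as `ϖ x`. -/
def HopfData.regrade (H : HopfData k G P) (ϖ : F →* G) (E : F → P →ₗ[k] P) : HopfData k F P where
  proj := E
  act x := H.act (ϖ x)
  mul := H.mul
  one := H.one
  comul := H.comul
  counit := H.counit
  antipode := H.antipode

variable {A : Type*} [AddCommMonoid A] [DecidableEq A] {Φ : G → G → G → kˣ} {H : HopfData k G P}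
  {𝒢 : A → Submodule k P}

namespace IsHopfGrading

/-- If the components of a grading of `H` by `A` are concentrated in the `G`-degrees given by
`A → F → G`, then the grading by `F` obtained by coarsening is a Yetter-Drinfeld structure. -/
theorem regrade_yd [Fintype G] [Fintype F] (hG : IsHopfGrading H 𝒢) (hH : IsBraidedHopf Φ H)
    (ϖ : F →* G) (deg : A → F)
    (hdeg : ∀ d, ∀ v ∈ 𝒢 d, H.proj (ϖ (deg d)) v = v) :
    IsTwistedYD (pullback ϖ Φ) (H.regrade ϖ (coarseProj hG.internal deg)).toYDData where
  proj_self g v := by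
    refine LinearMap.congr_fun (f := coarseProj hG.internal deg g ∘ₗ coarseProj hG.internal deg g)
      (g := coarseProj hG.internal deg g) (hom_ext_of_isInternal hG.internal fun d v hv => ?_) v
    by_cases hd : deg d = g
    · rw [LinearMap.comp_apply, coarseProj_of_eq _ hv hd, coarseProj_of_eq _ hv hd]
    · rw [LinearMap.comp_apply, coarseProj_of_ne _ hv hd, map_zero]
  proj_ne g h v hgh := by
    refine LinearMap.congr_fun (f := coarseProj hG.internal deg g ∘ₗ coarseProj hG.internal deg h)
      (g := 0) (hom_ext_of_isInternal hG.internal fun d v hv => ?_) v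
    by_cases hd : deg d = h
    · rw [LinearMap.comp_apply, coarseProj_of_eq _ hv hd,
        coarseProj_of_ne _ hv (hd.trans_ne hgh.symm), LinearMap.zero_apply]
    · rw [LinearMap.comp_apply, coarseProj_of_ne _ hv hd, map_zero, LinearMap.zero_apply]
  sum_proj v := by
    have := LinearMap.congr_fun (f := ∑ g, coarseProj hG.internal deg g) (g := LinearMap.id)
      (hom_ext_of_isInternal hG.internal fun d v hv => ?_) v
    · simpa [HopfData.regrade] using this
    · rw [LinearMap.sum_apply, Finset.sum_eq_single (deg d), coarseProj_of_eq _ hv rfl,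
        LinearMap.id_apply]
      · exact fun g _ hg => coarseProj_of_ne _ hv hg.symm
      · simp
  act_proj e g v := by
    refine LinearMap.congr_fun (f := H.act (ϖ e) ∘ₗ coarseProj hG.internal deg g)
      (g := coarseProj hG.internal deg g ∘ₗ H.act (ϖ e))
      (hom_ext_of_isInternal hG.internal fun d v hv => ?_) v
    have hv' := (hG.sub d).act_mem (ϖ e) trivial v hv
    by_cases hd : deg d = g
    · rw [LinearMap.comp_apply, LinearMap.comp_apply, coarseProj_of_eq _ hv hd,
        coarseProj_of_eq _ hv' hd]
    · rw [LinearMap.comp_apply, LinearMap.comp_apply, coarseProj_of_ne _ hv hd,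
        coarseProj_of_ne _ hv' hd, map_zero]
  act_one v := by
    change H.act (ϖ 1) v = v
    rw [map_one, hH.yd.act_one]
  act_act e f g v := by
    change H.act (ϖ e) (H.act (ϖ f) (coarseProj hG.internal deg g v)) =
      slant Φ (ϖ g) (ϖ e) (ϖ f) • H.act (ϖ (e * f)) (coarseProj hG.internal deg g v)
    rw [map_mul]
    refine LinearMap.congr_fun
      (f := H.act (ϖ e) ∘ₗ H.act (ϖ f) ∘ₗ coarseProj hG.internal deg g)
      (g := slant Φ (ϖ g) (ϖ e) (ϖ f) • (H.act (ϖ e * ϖ f) ∘ₗ coarseProj hG.internal deg g))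
      (hom_ext_of_isInternal hG.internal fun d v hv => ?_) v
    simp only [LinearMap.comp_apply, LinearMap.smul_apply]
    by_cases hd : deg d = g
    · rw [coarseProj_of_eq _ hv hd, ← hd, ← hdeg d v hv, hH.yd.act_act]
    · rw [coarseProj_of_ne _ hv hd]
      simp

theorem isHomog_of_regrade [Fintype G] (hG : IsHopfGrading H 𝒢) (hH : IsBraidedHopf Φ H)
    {ϖ : F →* G} {deg : A → F} (hdeg : ∀ d, ∀ v ∈ 𝒢 d, H.proj (ϖ (deg d)) v = v) {x : F} {a : P}
    (ha : coarseProj hG.internal deg x a = a) : H.IsHomog (ϖ x) a := by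
  apply hH.yd.isHomog
  rw [← ha]
  refine LinearMap.congr_fun (f := H.proj (ϖ x) ∘ₗ coarseProj hG.internal deg x)
    (g := coarseProj hG.internal deg x) (hom_ext_of_isInternal hG.internal fun d v hv => ?_) a
  rw [LinearMap.comp_apply]
  by_cases hd : deg d = x
  · rw [coarseProj_of_eq _ hv hd, ← hd, hdeg d v hv]
  · rw [coarseProj_of_ne _ hv hd, map_zero]

theorem regrade_hopf [Fintype G] [Fintype F] (hG : IsHopfGrading H 𝒢) (hH : IsBraidedHopf Φ H)
    (ϖ : F →* G) (deg : A → F)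
    (hdeg : ∀ d, ∀ v ∈ 𝒢 d, H.proj (ϖ (deg d)) v = v) (hzero : deg 0 = 1)
    (hadd : ∀ a b, deg (a + b) = deg a * deg b) :
    IsBraidedHopf (pullback ϖ Φ) (H.regrade ϖ (coarseProj hG.internal deg)) := by
  have hyd := hG.regrade_yd hH ϖ deg hdeg
  have hhom {x : F} {a : P}
      (ha : (H.regrade ϖ (coarseProj hG.internal deg)).toYDData.IsHomog x a) :
      H.IsHomog (ϖ x) a := hG.isHomog_of_regrade hH hdeg ha.1
  have hproj (x : F) (v : P) : H.proj (ϖ x) (coarseProj hG.internal deg x v) =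
      coarseProj hG.internal deg x v := (hhom (hyd.isHomog_proj x v)).1
  exact
  { yd := hyd
    proj_one := coarseProj_of_eq _ hG.one_mem hzero
    act_one := fun e => hH.act_one (ϖ e)
    proj_mul := fun g h x y => by
      refine LinearMap.congr_fun (LinearMap.congr_fun
        (f := (H.mul.compl₁₂ (coarseProj hG.internal deg g) (coarseProj hG.internal deg h)).compr₂
          (coarseProj hG.internal deg (g * h)))
        (g := H.mul.compl₁₂ (coarseProj hG.internal deg g) (coarseProj hG.internal deg h))
        (hom_ext_of_isInternal hG.internal fun c x hx =>
          hom_ext_of_isInternal hG.internal fun d y hy => ?_) x) y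
      simp only [LinearMap.compr₂_apply, LinearMap.compl₁₂_apply]
      by_cases hc : deg c = g
      · by_cases hd : deg d = h
        · rw [coarseProj_of_eq _ hx hc, coarseProj_of_eq _ hy hd,
            coarseProj_of_eq _ (hG.mul_mem c d x hx y hy) (by rw [hadd, hc, hd])]
        · rw [coarseProj_of_ne _ hy hd, map_zero, map_zero]
      · rw [coarseProj_of_ne _ hx hc, map_zero, LinearMap.zero_apply, map_zero]
    act_mul := fun e g h x y => by
      have := hH.act_mul (ϖ e) (ϖ g) (ϖ h) (coarseProj hG.internal deg g x)
        (coarseProj hG.internal deg h y)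
      rw [hproj, hproj] at this
      exact this
    one_mul := hH.one_mul
    mul_one := hH.mul_one
    mul_assoc := fun e f g x y z => by
      have := hH.mul_assoc (ϖ e) (ϖ f) (ϖ g) (coarseProj hG.internal deg e x)
        (coarseProj hG.internal deg f y) (coarseProj hG.internal deg g z)
      rw [hproj, hproj, hproj] at this
      exact this
    counit_proj := fun x => by
      refine LinearMap.congr_fun (f := H.counit ∘ₗ coarseProj hG.internal deg 1) (g := H.counit)
        (hom_ext_of_isInternal hG.internal fun d v hv => ?_) x
      rw [LinearMap.comp_apply]
      by_cases hd : deg d = 1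
      · rw [coarseProj_of_eq _ hv hd]
      · rw [coarseProj_of_ne _ hv hd, map_zero, hG.counit_eq_zero d _ v hv]
        rintro rfl
        exact hd hzero
    counit_act := fun e => hH.counit_act (ϖ e)
    comul_proj := fun g x => by
      refine LinearMap.congr_fun (f := H.comul ∘ₗ coarseProj hG.internal deg g)
        (g := tensorProj (H.regrade ϖ (coarseProj hG.internal deg)).toYDData g ∘ₗ H.comul)
        (hom_ext_of_isInternal hG.internal fun d v hv => ?_) x
      rw [LinearMap.comp_apply, LinearMap.comp_apply]
      have hspan := hG.comul_mem d v hv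
      have hmem {c : A} {y : P} (hy : y ∈ 𝒢 c) :
          (H.regrade ϖ (coarseProj hG.internal deg)).IsHomog (deg c) y :=
        hyd.isHomog (coarseProj_of_eq _ hy rfl)
      by_cases hd : deg d = g
      · rw [coarseProj_of_eq _ hv hd]
        refine (LinearMap.eqOn_span (f := tensorProj _ g) (g := LinearMap.id) ?_ hspan).symm
        rintro _ ⟨b, c, hbc, y, hy, z, hz, rfl⟩
        exact tensorProj_tmul_of_eq (hmem hy) (hmem hz) (by rw [← hadd, hbc, hd])
      · rw [coarseProj_of_ne _ hv hd, map_zero]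
        refine (LinearMap.eqOn_span (f := tensorProj _ g) (g := 0) ?_ hspan).symm
        rintro _ ⟨b, c, hbc, y, hy, z, hz, rfl⟩
        exact tensorProj_tmul_of_ne (hmem hy) (hmem hz) (by rwa [← hadd, hbc])
    comul_act := fun e x => by
      refine (hH.comul_act (ϖ e) x).trans (LinearMap.congr_fun
        (hyd.tensor_ext fun g a h b ha hb => ?_) (H.comul x))
      exact (tensorAct_tmul Φ (ϖ e) (hhom ha) (hhom hb)).trans
        (tensorAct_tmul (pullback ϖ Φ) e ha hb).symm
    counit_comul := hH.counit_comul
    comul_counit := hH.comul_counit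
    coassoc := fun x => by
      refine Eq.trans ?_ (hH.coassoc x)
      refine LinearMap.congr_fun (hyd.tensor_ext₃ fun g a h b l c ha hb hc => ?_) _
      exact (associator_tmul (pullback ϖ Φ) ha hb hc).trans
        (associator_tmul Φ (hhom ha) (hhom hb) (hhom hc)).symm
    counit_one := hH.counit_one
    counit_mul := hH.counit_mul
    comul_one := hH.comul_one
    comul_mul := fun x y => by
      refine (hH.comul_mul x y).trans (LinearMap.congr_fun
        (hyd.tensor_ext₄ fun g a h b l c m d ha hb hc hd => ?_) _)
      rw [tensorMul_tmul Φ (hhom ha) (hhom hb) (hhom hc) (hhom hd),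
        tensorMul_tmul (pullback ϖ Φ) ha hb hc hd]
      simp only [pullback, map_mul]
      rfl
    antipode_proj := fun g x => by
      refine LinearMap.congr_fun (f := H.antipode ∘ₗ coarseProj hG.internal deg g)
        (g := coarseProj hG.internal deg g ∘ₗ H.antipode)
        (hom_ext_of_isInternal hG.internal fun d v hv => ?_) x
      have hv' := hG.antipode_mem d v hv
      by_cases hd : deg d = g
      · rw [LinearMap.comp_apply, LinearMap.comp_apply, coarseProj_of_eq _ hv hd,
          coarseProj_of_eq _ hv' hd]
      · rw [LinearMap.comp_apply, LinearMap.comp_apply, coarseProj_of_ne _ hv hd,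
          coarseProj_of_ne _ hv' hd, map_zero]
    antipode_act := fun e => hH.antipode_act (ϖ e)
    antipode_left := hH.antipode_left
    antipode_right := hH.antipode_right }

/-- Any grading of `H` whose components are stable under the coarsened projections is a grading of
the algebra with the changed group. -/
theorem regrade (hG : IsHopfGrading H 𝒢) (ϖ : F →* G) (deg : A → F) {B : Type*} [AddCommMonoid B]
    [DecidableEq B] {𝒩 : B → Submodule k P} (hN : IsHopfGrading H 𝒩)
    (hstable : ∀ x n, ∀ v ∈ 𝒩 n, coarseProj hG.internal deg x v ∈ 𝒩 n) :
    IsHopfGrading (H.regrade ϖ (coarseProj hG.internal deg)) 𝒩 where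
  internal := hN.internal
  sub n := ⟨fun x v hv => hstable x n v hv, fun x _ v hv => (hN.sub n).act_mem (ϖ x) trivial v hv⟩
  one_mem := hN.one_mem
  mul_mem := hN.mul_mem
  counit_eq_zero := hN.counit_eq_zero
  comul_mem := hN.comul_mem
  antipode_mem := hN.antipode_mem

end IsHopfGrading

end Regrade

/-! ### Graded pre-Nichols algebras under twisting and change of the group -/

section TwistPreNichols

variable {k : Type*} [Field k] {G : Type*} [CommGroup G] [Fintype G]
variable {P : Type*} [AddCommGroup P] [Module k P] {Φ : G → G → G → kˣ}
  {H : HopfData k G P} {K : G → G → kˣ}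

theorem IsSubobject.twist {F : Subgroup G} {U : Submodule k P}
    (hU : IsSubobject F H.toYDData U) : IsSubobject F (H.twist K).toYDData U where
  proj_mem := hU.proj_mem
  act_mem g hg u hu := by
    simp only [HopfData.twist, LinearMap.sum_apply, LinearMap.smul_apply, LinearMap.comp_apply]
    exact sum_mem fun x _ => U.smul_of_tower_mem _ (hU.act_mem g hg _ (hU.proj_mem x u hu))

theorem IsHopfGrading.twist {A : Type*} [AddCommMonoid A] [DecidableEq A]
    {𝒢 : A → Submodule k P} (hG : IsHopfGrading H 𝒢) : IsHopfGrading (H.twist K) 𝒢 where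
  internal := hG.internal
  sub a := (hG.sub a).twist
  one_mem := hG.one_mem
  mul_mem a b x hx y hy := by
    simp only [HopfData.twist, LinearMap.sum_apply, LinearMap.smul_apply,
      LinearMap.compl₁₂_apply]
    exact sum_mem fun g _ => sum_mem fun h _ => (𝒢 (a + b)).smul_of_tower_mem _
      (hG.mul_mem a b _ ((hG.sub a).proj_mem g x hx) _ ((hG.sub b).proj_mem h y hy))
  counit_eq_zero := hG.counit_eq_zero
  comul_mem a x hx := by
    rw [twist_comul]
    set S := Submodule.span k
      {t | ∃ b c, b + c = a ∧ ∃ y ∈ 𝒢 b, ∃ z ∈ 𝒢 c, t = y ⊗ₜ[k] z} with hS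
    have : S ≤ S.comap (tensorScale H.toYDData H.toYDData fun x y => (K x y)⁻¹) := by
      conv_lhs => rw [hS]
      rw [Submodule.span_le]
      rintro _ ⟨b, c, hbc, y, hy, z, hz, rfl⟩
      simp only [SetLike.mem_coe, Submodule.mem_comap, tensorScale, LinearMap.sum_apply,
        LinearMap.smul_apply, TensorProduct.map_tmul]
      exact sum_mem fun g _ => sum_mem fun h _ => S.smul_of_tower_mem _ (Submodule.subset_span
        ⟨b, c, hbc, _, (hG.sub b).proj_mem g y hy, _, (hG.sub c).proj_mem h z hz, rfl⟩)
    exact this (hG.comul_mem a x hx)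
  antipode_mem := hG.antipode_mem

theorem IsPreNichols.twist {V : Submodule k P} (h : IsPreNichols Φ H V)
    (hV : ∀ g, ∀ v ∈ V, H.proj g v ∈ V) (hK : IsNormalizedTwoCochain K) :
    IsPreNichols (Φ * coboundary K) (H.twist K) V where
  hopf := h.hopf.twist hK
  finite := h.finite
  grading := by
    obtain ⟨𝒩, hN, h0, h1⟩ := h.grading
    exact ⟨𝒩, hN.twist, h0, h1⟩
  generated S hone hVS hmul := by
    -- the elements all of whose homogeneous components lie in `S` form a subalgebra of `H`
    let T : Submodule k P := ⨅ g, S.comap (H.proj g)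
    have hT {x : P} : x ∈ T ↔ ∀ g, H.proj g x ∈ S := by simp [T]
    have htop : T = ⊤ := by
      refine h.generated T (hT.2 fun g => ?_) (fun v hv => hT.2 fun g => hVS (hV g v hv))
        (fun x hx y hy => hT.2 fun g => ?_)
      · by_cases hg : g = 1
        · rw [hg, h.hopf.proj_one]
          exact hone
        · rw [h.hopf.isHomog_one.2 g hg]
          exact zero_mem _
      · rw [hT] at hx hy
        rw [← h.hopf.yd.sum_proj x, ← h.hopf.yd.sum_proj y]
        simp only [map_sum, LinearMap.sum_apply]
        refine sum_mem fun b _ => sum_mem fun a _ => ?_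
        have ha := h.hopf.yd.isHomog_proj a x
        have hb := h.hopf.yd.isHomog_proj b y
        have hmem : H.mul (H.proj a x) (H.proj b y) ∈ S := by
          have := hmul _ (hx a) _ (hy b)
          rw [twist_mul ha hb] at this
          rw [← inv_smul_smul (K a b) (H.mul (H.proj a x) (H.proj b y))]
          exact S.smul_of_tower_mem _ this
        have hhom := h.hopf.isHomog_mul ha hb
        by_cases hg : g = a * b
        · rw [hg, hhom.1]
          exact hmem
        · rw [hhom.2 g hg]
          exact zero_mem _
    rw [eq_top_iff]
    intro x _
    rw [← h.hopf.yd.sum_proj x]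
    have hx : x ∈ T := htop ▸ trivial
    exact sum_mem fun g _ => hT.1 hx g

variable {θ : ℕ} {V : Fin θ → Submodule k P} {𝒢 : (Fin θ → ℕ) → Submodule k P}

theorem IsGradedPreNichols.twist (h : IsGradedPreNichols Φ H V 𝒢)
    (hK : IsNormalizedTwoCochain K) :
    IsGradedPreNichols (Φ * coboundary K) (H.twist K) V 𝒢 where
  preNichols := h.preNichols.twist (fun g => by
    change (⨆ i, V i) ≤ (⨆ i, V i).comap (H.proj g)
    exact iSup_le fun i v hv => Submodule.mem_iSup_of_mem i ((h.sub i).proj_mem g v hv)) hK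
  indep := h.indep
  ne_bot := h.ne_bot
  sub i := (h.sub i).twist
  homogeneous := h.homogeneous
  grading := h.grading.twist
  deg := h.deg

/-- A multiplicative family of subspaces which contains the unit and the generators in the right
degrees contains the components of the `ℕ^θ`-grading. -/
theorem IsGradedPreNichols.component_le (h : IsGradedPreNichols Φ H V 𝒢)
    {W : (Fin θ → ℕ) → Submodule k P} (hone : H.one ∈ W 0) (hV : ∀ i, V i ≤ W (Pi.single i 1))
    (hmul : ∀ a b, ∀ x ∈ W a, ∀ y ∈ W b, H.mul x y ∈ W (a + b))
    (d : Fin θ → ℕ) : 𝒢 d ≤ W d := by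
  refine le_of_iSup_inf_eq_top h.grading.internal ?_ d
  refine h.preNichols.generated _ (Submodule.mem_iSup_of_mem 0 ⟨h.grading.one_mem, hone⟩)
    (iSup_le fun i => le_iSup_of_le (Pi.single i 1) (le_inf (h.deg i) (hV i))) ?_
  intro x hx y hy
  induction hx using Submodule.iSup_induction' with
  | mem a x hx =>
    induction hy using Submodule.iSup_induction' with
    | mem b y hy =>
      exact Submodule.mem_iSup_of_mem (a + b)
        ⟨h.grading.mul_mem a b x hx.1 y hy.1, hmul a b x hx.2 y hy.2⟩
    | zero => rw [map_zero]; exact zero_mem _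
    | add y z _ _ hy hz => rw [map_add]; exact add_mem hy hz
  | zero => rw [map_zero, LinearMap.zero_apply]; exact zero_mem _
  | add x z _ _ hx hz => rw [map_add, LinearMap.add_apply]; exact add_mem hx hz

/-- Each component of the `ℕ^θ`-grading is concentrated in one `G`-degree. -/
theorem IsGradedPreNichols.proj_component (h : IsGradedPreNichols Φ H V 𝒢)
    {γ : (Fin θ → ℕ) → G} (hzero : γ 0 = 1) (hadd : ∀ a b, γ (a + b) = γ a * γ b)
    (hγ : ∀ i, ∀ v ∈ V i, H.proj (γ (Pi.single i 1)) v = v) (d : Fin θ → ℕ) :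
    ∀ v ∈ 𝒢 d, H.proj (γ d) v = v := by
  refine h.component_le (W := fun d => LinearMap.eqLocus (H.proj (γ d)) LinearMap.id) ?_ hγ ?_ d
  · change H.proj (γ 0) H.one = H.one
    rw [hzero, h.preNichols.hopf.proj_one]
  · intro a b x hx y hy
    have ha := h.preNichols.hopf.yd.isHomog (show H.proj (γ a) x = x from hx)
    have hb := h.preNichols.hopf.yd.isHomog (show H.proj (γ b) y = y from hy)
    change H.proj (γ (a + b)) (H.mul x y) = H.mul x y
    rw [hadd]
    exact (h.preNichols.hopf.isHomog_mul ha hb).1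

/-- In an `ℕ`-grading with `V` in degree one, the component of `ℕ^θ`-degree `d` has degree
`∑ d i`. -/
theorem IsGradedPreNichols.component_le_total (h : IsGradedPreNichols Φ H V 𝒢)
    {𝒩 : ℕ → Submodule k P} (hN : IsHopfGrading H 𝒩) (h1 : 𝒩 1 = ⨆ i, V i) (d : Fin θ → ℕ) :
    𝒢 d ≤ 𝒩 (∑ i, d i) := by
  refine h.component_le (W := fun d => 𝒩 (∑ i, d i)) ?_ (fun i => ?_) ?_ d
  · simpa using hN.one_mem
  · simpa [h1] using le_iSup V i
  · intro a b x hx y hy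
    simp only [Pi.add_apply, Finset.sum_add_distrib]
    exact hN.mul_mem _ _ x hx y hy

/-- Change of the group for graded pre-Nichols algebras. The `ℕ`-grading survives because its
projections commute with those of the new grading. -/
theorem IsGradedPreNichols.regrade {F : Type*} [CommGroup F] [Fintype F]
    (h : IsGradedPreNichols Φ H V 𝒢) (ϖ : F →* G) {deg : (Fin θ → ℕ) → F} (hzero : deg 0 = 1)
    (hadd : ∀ a b, deg (a + b) = deg a * deg b)
    (hdeg : ∀ d, ∀ v ∈ 𝒢 d, H.proj (ϖ (deg d)) v = v) :
    IsGradedPreNichols (pullback ϖ Φ) (H.regrade ϖ (coarseProj h.grading.internal deg)) V 𝒢 where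
  preNichols :=
    { hopf := h.grading.regrade_hopf h.preNichols.hopf ϖ deg hdeg hzero hadd
      finite := h.preNichols.finite
      grading := by
        obtain ⟨𝒩, hN, h0, h1⟩ := h.preNichols.grading
        refine ⟨𝒩, h.grading.regrade ϖ deg hN fun x n v hv => ?_, h0, h1⟩
        -- the projections of the two gradings commute
        have hcomm := LinearMap.congr_fun
          (f := coarseProj h.grading.internal deg x ∘ₗ coarseProj hN.internal id n)
          (g := coarseProj hN.internal id n ∘ₗ coarseProj h.grading.internal deg x)
          (hom_ext_of_isInternal h.grading.internal fun d v hv => ?_) v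
        · rw [LinearMap.comp_apply, LinearMap.comp_apply,
            coarseProj_of_eq hN.internal hv (deg := id) (x := n) rfl] at hcomm
          rw [hcomm]
          have hle : (⊤ : Submodule k P) ≤ (𝒩 n).comap (coarseProj hN.internal id n) := by
            rw [← hN.internal.submodule_iSup_eq_top]
            refine iSup_le fun j w hw => ?_
            rw [Submodule.mem_comap]
            by_cases hj : j = n
            · subst hj
              rwa [coarseProj_of_eq hN.internal hw (deg := id) (x := j) rfl]
            · rw [coarseProj_of_ne hN.internal hw (deg := id) hj]
              exact zero_mem _
          exact hle trivial
        · have hv' := h.component_le_total hN h1 d hv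
          have hx : coarseProj h.grading.internal deg x v = v ∨
              coarseProj h.grading.internal deg x v = 0 := by
            by_cases hd : deg d = x
            · exact Or.inl (coarseProj_of_eq _ hv hd)
            · exact Or.inr (coarseProj_of_ne _ hv hd)
          have hn : coarseProj hN.internal id n v = v ∨ coarseProj hN.internal id n v = 0 := by
            by_cases hd : id (∑ i, d i) = n
            · exact Or.inl (coarseProj_of_eq _ hv' hd)
            · exact Or.inr (coarseProj_of_ne _ hv' hd)
          rw [LinearMap.comp_apply, LinearMap.comp_apply]
          rcases hx with hx | hx <;> rcases hn with hn | hn <;> simp [hx, hn]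
      generated := h.preNichols.generated }
  indep := h.indep
  ne_bot := h.ne_bot
  sub i := by
    refine ⟨fun x v hv => ?_, fun x _ v hv => (h.sub i).act_mem (ϖ x) trivial v hv⟩
    change coarseProj h.grading.internal deg x v ∈ V i
    by_cases hd : deg (Pi.single i 1) = x
    · rwa [coarseProj_of_eq _ (h.deg i hv) hd]
    · rw [coarseProj_of_ne _ (h.deg i hv) hd]
      exact zero_mem _
  homogeneous i := ⟨deg (Pi.single i 1), fun v hv => coarseProj_of_eq _ (h.deg i hv) rfl⟩
  grading := by
    refine h.grading.regrade ϖ deg h.grading fun x d v hv => ?_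
    by_cases hd : deg d = x
    · rwa [coarseProj_of_eq _ hv hd]
    · rw [coarseProj_of_ne _ hv hd]
      exact zero_mem _
  deg := h.deg

end TwistPreNichols

section Diagonal

variable {k : Type*} [Field k] {G : Type*} [CommGroup G] [Fintype G]
variable {V : Type*} [AddCommGroup V] [Module k V] {Φ : G → G → G → kˣ} {D : YDData k G V}

theorem eq_of_tmul_eq_tmul {a b x : V} (hx : x ≠ 0) (h : a ⊗ₜ[k] x = b ⊗ₜ[k] x) : a = b := by
  obtain ⟨f, hf⟩ := Module.Projective.exists_dual_eq_one k hx
  have := congrArg (fun t => TensorProduct.rid k V (f.lTensor V t)) h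
  simpa [hf] using this

theorem IsTwistedYD.act_ne_zero (hD : IsTwistedYD Φ D) (z : G) {g : G} {a : V}
    (ha : D.IsHomog g a) (hne : a ≠ 0) : D.act z a ≠ 0 := by
  intro h
  have := hD.act_act z⁻¹ z g a
  rw [ha.1, h, map_zero, inv_mul_cancel, hD.act_one, eq_comm, smul_eq_zero_iff_eq] at this
  exact hne this

/-- On a module of diagonal type the support group acts by commuting operators, which forces the
2-cocycles `Φ_g` to be symmetric on it. -/
theorem IsDiagonal.slant_symm (hD : IsTwistedYD Φ D) (hΦ : IsNormalizedThreeCocycle Φ)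
    {U : Submodule k V} (hU : IsDiagonal D U) {g x y : G} (hg : g ∈ supportGroup D U)
    (hx : x ∈ supportGroup D U) (hy : y ∈ supportGroup D U) :
    slant Φ g x y = slant Φ g y x := by
  obtain ⟨N, X, q, hX, hq⟩ := hU
  have hX0 (i) : (X i : V) ≠ 0 := fun h => X.ne_zero i (Subtype.ext h)
  have hbasis : ∀ g ∈ {g | ∃ u ∈ U, D.proj g u ≠ 0}, ∃ i, D.IsHomog g (X i : V) := by
    rintro g ⟨u, hu, hgu⟩
    by_contra! hcon
    have : D.proj g ∘ₗ U.subtype = 0 := X.ext fun i => by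
      obtain ⟨l, hl⟩ := hX i
      have hXl := hD.isHomog hl
      have hgl : g ≠ l := by
        rintro rfl
        exact hcon i hXl
      exact hXl.2 g hgl
    exact hgu (LinearMap.congr_fun this ⟨u, hu⟩)
  have hact {g : G} {i} (hi : D.IsHomog g (X i : V)) (j) :
      D.act g (X j : V) = q i j • (X j : V) := by
    have := hq i j
    rw [braiding_tmul hi, ← units_smul_tmul] at this
    exact eq_of_tmul_eq_tmul (hX0 i) this
  refine slant_symm_of_closure hΦ (fun g hg x hx y hy => ?_) hg hx hy
  obtain ⟨c, hc⟩ := hbasis g hg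
  obtain ⟨a, ha⟩ := hbasis x hx
  obtain ⟨b, hb⟩ := hbasis y hy
  have h1 := hD.act_act x y g (X c)
  have h2 := hD.act_act y x g (X c)
  rw [hc.1, hact hb, LinearMap.map_smul_of_tower, hact ha] at h1
  rw [hc.1, hact ha, LinearMap.map_smul_of_tower, hact hb, smul_comm, mul_comm y x] at h2
  have h3 := h1.symm.trans h2
  rw [Units.smul_def, Units.smul_def] at h3
  exact Units.ext (smul_left_injective k (hD.act_ne_zero _ hc (hX0 c)) h3)

end Diagonal

/-! ### The covering group of the support group -/

theorem hatProj_surjective {n : ℕ} (m : Fin n → ℕ) [∀ i, NeZero (m i)] :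
    Function.Surjective (hatProj m) := fun c => by
  choose f hf using fun i => cyclicProj_surjective (m i) (c i)
  exact ⟨f, funext hf⟩

theorem exists_hatMap_eq {G : Type*} [CommGroup G] {S : Subgroup G} {n : ℕ} {m : Fin n → ℕ}
    [∀ i, NeZero (m i)] (e : CyclicProduct m ≃* S) {g : G} (hg : g ∈ S) :
    ∃ x, hatMap e x = g := by
  obtain ⟨x, hx⟩ := hatProj_surjective m (e.symm ⟨g, hg⟩)
  refine ⟨x, ?_⟩
  change ((e (hatProj m x) : S) : G) = g
  rw [hx, e.apply_symm_apply]

theorem hatMap_mem {G : Type*} [CommGroup G] {S : Subgroup G} {n : ℕ} {m : Fin n → ℕ}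
    (e : CyclicProduct m ≃* S) (x : HatGroup m) : hatMap e x ∈ S :=
  (e (hatProj m x)).2

/-- A 3-cocycle whose `Φ_g` are symmetric on a finite subgroup becomes trivial on the covering group
of this subgroup. -/
theorem exists_trivialization {k : Type*} [Field k] [IsAlgClosed k] {G : Type*} [CommGroup G]
    {Φ : G → G → G → kˣ} (hΦ : IsNormalizedThreeCocycle Φ) {S : Subgroup G}
    (hS : ∀ g ∈ S, ∀ x ∈ S, ∀ y ∈ S, slant Φ g x y = slant Φ g y x)
    {n : ℕ} {m : Fin n → ℕ} [∀ i, NeZero (m i)] (e : CyclicProduct m ≃* S) :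
    ∃ J : HatGroup m → HatGroup m → kˣ, IsNormalizedTwoCochain J ∧
      coboundary J = pullback (hatMap e) Φ :=
  (IsTrivializingCover.hatProj m).trivializes (pullback (S.subtype.comp e.toMonoidHom) Φ)
    (hΦ.pullback _) fun g x y => hS _ (e g).2 _ (e x).2 _ (e y).2

theorem mul_coboundary_inv {k : Type*} [Field k] {G : Type*} [CommGroup G] (J : G → G → kˣ) :
    coboundary J * coboundary J⁻¹ = 1 := by
  funext x y z
  apply Additive.ofMul.injective
  simp only [coboundary, Pi.mul_apply, Pi.inv_apply, Pi.one_apply, ofMul_mul, ofMul_div,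
    ofMul_inv, ofMul_one]
  abel

section RegradeTwist

variable {k : Type*} [Field k] {G F : Type*} [CommGroup G] [CommGroup F] [Fintype F]
variable {P : Type*} [AddCommGroup P] [Module k P] {H : HopfData k G P} {ϖ : F →* G}
  {E : F → P →ₗ[k] P} {K : F → F → kˣ}

theorem regrade_twist_act {x : F} {v : P}
    (hv : (H.regrade ϖ E).toYDData.IsHomog x v) (y : F) :
    ((H.regrade ϖ E).twist K).act y v = (K y x / K x y) • H.act (ϖ y) v :=
  twist_act y hv

/-- On a subspace which is concentrated in one degree, a twisting only rescales the action, so it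
does not change the subobjects. -/
theorem isSubobject_regrade_twist_iff {S : Subgroup G} (hS : ∀ g, g ∈ S ↔ ∃ y, ϖ y = g)
    {x : F} {l : G} {U : Submodule k P}
    (hUx : ∀ v ∈ U, (H.regrade ϖ E).toYDData.IsHomog x v) (hUl : ∀ v ∈ U, H.IsHomog l v) :
    IsSubobject ⊤ ((H.regrade ϖ E).twist K).toYDData U ↔ IsSubobject S H.toYDData U := by
  constructor
  · intro h
    refine ⟨fun g v hv => ?_, fun g hg v hv => ?_⟩
    · by_cases hg : g = l
      · rwa [hg, (hUl v hv).1]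
      · rw [(hUl v hv).2 g hg]
        exact zero_mem _
    · obtain ⟨y, rfl⟩ := (hS g).1 hg
      have := h.act_mem y trivial v hv
      rw [regrade_twist_act (hUx v hv)] at this
      rw [← inv_smul_smul (K y x / K x y) (H.act (ϖ y) v)]
      exact U.smul_of_tower_mem _ this
  · intro h
    refine ⟨fun g v hv => ?_, fun y _ v hv => ?_⟩
    · change E g v ∈ U
      by_cases hg : g = x
      · rw [hg]
        exact ((hUx v hv).1 : E x v = v).symm ▸ hv
      · exact ((hUx v hv).2 g hg : E g v = 0).symm ▸ zero_mem _
    · rw [regrade_twist_act (hUx v hv)]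
      exact U.smul_of_tower_mem _ (h.act_mem _ ((hS _).2 ⟨y, rfl⟩) v hv)

theorem isSimpleSubobject_regrade_twist_iff {S : Subgroup G} (hS : ∀ g, g ∈ S ↔ ∃ y, ϖ y = g)
    {x : F} {l : G} {U : Submodule k P}
    (hUx : ∀ v ∈ U, (H.regrade ϖ E).toYDData.IsHomog x v) (hUl : ∀ v ∈ U, H.IsHomog l v) :
    IsSimpleSubobject ⊤ ((H.regrade ϖ E).twist K).toYDData U ↔
      IsSimpleSubobject S H.toYDData U := by
  have hiff {U' : Submodule k P} (hle : U' ≤ U) :=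
    isSubobject_regrade_twist_iff (K := K) hS (fun v hv => hUx v (hle hv))
      (fun v hv => hUl v (hle hv))
  constructor
  · exact fun h => ⟨(hiff le_rfl).1 h.sub, h.ne_bot, fun U' hle hU' =>
      h.eq_bot_or_eq U' hle ((hiff hle).2 hU')⟩
  · exact fun h => ⟨(hiff le_rfl).2 h.sub, h.ne_bot, fun U' hle hU' =>
      h.eq_bot_or_eq U' hle ((hiff hle).1 hU')⟩

/-- If the `F`-degree of the homogeneous elements of `U` is determined by their `G`-degree, then
the regraded and twisted structure on `U` is again of diagonal type. -/
theorem IsDiagonal.regrade_twist [Fintype G] {U : Submodule k P}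
    (hU : IsDiagonal H.toYDData U) {σ : G → F} (hH : ∀ g v, H.proj g v = v → H.IsHomog g v)
    (hσ : ∀ g, ∀ v ∈ U, v ≠ 0 → H.proj g v = v →
      ϖ (σ g) = g ∧ (H.regrade ϖ E).toYDData.IsHomog (σ g) v) :
    IsDiagonal ((H.regrade ϖ E).twist K).toYDData U := by
  obtain ⟨N, X, q, hX, hq⟩ := hU
  have hX0 (i) : (X i : P) ≠ 0 := fun h => X.ne_zero i (Subtype.ext h)
  choose g hg using hX
  refine ⟨N, X, fun i j => K (σ (g i)) (σ (g j)) / K (σ (g j)) (σ (g i)) * q i j,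
    fun i => ⟨σ (g i), (hσ _ _ (X i).2 (hX0 i) (hg i)).2.1⟩, fun i j => ?_⟩
  obtain ⟨hi, hi'⟩ := hσ _ _ (X i).2 (hX0 i) (hg i)
  obtain ⟨-, hj'⟩ := hσ _ _ (X j).2 (hX0 j) (hg j)
  have h := hq i j
  rw [braiding_tmul (hH _ _ (hg i))] at h
  rw [braiding_tmul (D := ((H.regrade ϖ E).twist K).toYDData) hi', regrade_twist_act hj', hi,
    units_smul_tmul, h, smul_smul]

end RegradeTwist

end TwistedYD

theorem proposition3p5
    {k : Type*} [Field k] [IsAlgClosed k] [CharZero k]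
    {G : Type*} [CommGroup G] [Fintype G]
    (Φ : G → G → G → kˣ) (hΦ : IsNormalizedThreeCocycle Φ)
    {P : Type u} [AddCommGroup P] [Module k P] (H : HopfData k G P)
    {θ : ℕ} (V : Fin θ → Submodule k P) (𝒢 : (Fin θ → ℕ) → Submodule k P)
    (hP : IsGradedPreNichols Φ H V 𝒢)
    (hsimple : ∀ i, IsSimpleSubobject ⊤ H.toYDData (V i))
    (hdiag : IsDiagonal H.toYDData (⨆ i, V i))
    {n : ℕ} (m : Fin n → ℕ) [∀ i, NeZero (m i)]
    (e : CyclicProduct m ≃* supportGroup H.toYDData (⨆ i, V i)) :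
    ∃ (Q : Type u) (_ : AddCommGroup Q) (_ : Module k Q) (M : HopfData k (HatGroup m) Q)
      (f : P ≃ₗ[k] Q) (J : HatGroup m → HatGroup m → kˣ),
      -- `P` is isomorphic to the graded pre-Nichols algebra `M` over `(k hat(G_V), π^* Φ)`
      IsGradedPreNichols (pullback (hatMap e) Φ) M
        (fun i => (V i).map (f : P →ₗ[k] Q)) (fun d => (𝒢 d).map (f : P →ₗ[k] Q)) ∧
      IsHopfIso H M f ∧
      IsChangeOfGroup (hatMap e) H.toYDData M.toYDData f ∧
      -- `J` trivializes the pull-back of `Φ`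
      IsNormalizedTwoCochain J ∧
      coboundary J = pullback (hatMap e) Φ ∧
      -- the twisting of `M` by `J⁻¹` is a graded pre-Nichols algebra of diagonal type in the
      -- ordinary category
      IsGradedPreNichols 1 (M.twist J⁻¹)
        (fun i => (V i).map (f : P →ₗ[k] Q)) (fun d => (𝒢 d).map (f : P →ₗ[k] Q)) ∧
      IsDiagonal (M.twist J⁻¹).toYDData (⨆ i, (V i).map (f : P →ₗ[k] Q)) ∧
      -- its summands are simple exactly when those of `P` are simple over `G_V`
      ∀ i, IsSimpleSubobject ⊤ (M.twist J⁻¹).toYDData ((V i).map (f : P →ₗ[k] Q)) ↔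
        IsSimpleSubobject (supportGroup H.toYDData (⨆ i, V i)) H.toYDData (V i) := by
  have hH := hP.preNichols.hopf
  obtain ⟨J, hJ, hJΦ⟩ := exists_trivialization hΦ
    (fun g hg x hx y hy => hdiag.slant_symm hH.yd hΦ hg hx hy) e
  set ϖ := hatMap e with hϖ
  -- a section of `ϖ` over the support group, so that the `V i` of equal `G`-degree get the same
  -- degree in the covering group
  have hrange (g : G) : g ∈ supportGroup H.toYDData (⨆ i, V i) ↔ ∃ x, ϖ x = g :=
    ⟨exists_hatMap_eq e, fun ⟨x, hx⟩ => hx ▸ hatMap_mem e x⟩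
  let σ : G → HatGroup m := Function.invFun ϖ
  have hσ {g : G} (hg : ∃ v ∈ ⨆ i, V i, H.proj g v ≠ 0) : ϖ (σ g) = g :=
    Function.invFun_eq ((hrange g).1 (Subgroup.subset_closure hg))
  choose γ hγ using hP.homogeneous
  have hγσ (i) : ϖ (σ (γ i)) = γ i := by
    obtain ⟨v, hv, hv0⟩ := (V i).ne_bot_iff.1 (hP.ne_bot i)
    exact hσ ⟨v, Submodule.mem_iSup_of_mem i hv, by rwa [hγ i v hv]⟩
  let deg : (Fin θ → ℕ) → HatGroup m := fun d => ∏ i, σ (γ i) ^ d i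
  have hzero : deg 0 = 1 := by simp [deg]
  have hadd (a b) : deg (a + b) = deg a * deg b := by
    simp [deg, pow_add, Finset.prod_mul_distrib]
  have hsingle (i) : deg (Pi.single i 1) = σ (γ i) := by
    simp only [deg]
    rw [Finset.prod_eq_single i (fun j _ hj => by rw [Pi.single_eq_of_ne hj, pow_zero]) (by simp),
      Pi.single_eq_same, pow_one]
  have hdeg : ∀ d, ∀ v ∈ 𝒢 d, H.proj (ϖ (deg d)) v = v :=
    hP.proj_component (γ := fun d => ϖ (deg d)) (by rw [hzero, map_one])
      (fun a b => by rw [hadd, map_mul]) (fun i v hv => by rw [hsingle, hγσ, hγ i v hv])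
  have hM := hP.regrade ϖ hzero hadd hdeg
  set E := coarseProj hP.grading.internal deg with hE
  have hMyd := hM.preNichols.hopf.yd
  have hVσ (i) (v) (hv : v ∈ V i) : (H.regrade ϖ E).IsHomog (σ (γ i)) v :=
    hMyd.isHomog (coarseProj_of_eq _ (hP.deg i hv) (hsingle i))
  have hEσ (g : G) (v) (hv : v ∈ ⨆ i, V i) : E (σ g) (H.proj g v) = H.proj g v := by
    have hle : ⨆ i, V i ≤ LinearMap.eqLocus (E (σ g) ∘ₗ H.proj g) (H.proj g) := by
      refine iSup_le fun i v hv => ?_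
      rw [LinearMap.mem_eqLocus, LinearMap.comp_apply]
      by_cases hg : g = γ i
      · rw [hg, hγ i v hv]
        exact (hVσ i v hv).1
      · rw [(hH.yd.isHomog (hγ i v hv)).2 g hg, map_zero]
    exact hle hv
  have hmap : (fun i => (V i).map ((LinearEquiv.refl k P : P ≃ₗ[k] P) : P →ₗ[k] P)) = V := by
    funext i
    simp
  have hmap' : (fun d => (𝒢 d).map ((LinearEquiv.refl k P : P ≃ₗ[k] P) : P →ₗ[k] P)) = 𝒢 := by
    funext i
    simp
  have hJinv : IsNormalizedTwoCochain J⁻¹ :=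
    ⟨fun x => by simp [hJ.one_left], fun x => by simp [hJ.one_right]⟩
  refine ⟨P, inferInstance, inferInstance, H.regrade ϖ E, LinearEquiv.refl k P, J, ?_, ?_, ?_, hJ,
    hJΦ, ?_, ?_, fun i => ?_⟩
  · rw [hmap, hmap']
    exact hM
  · refine ⟨rfl, fun _ _ => rfl, fun _ => rfl, fun x => ?_⟩
    simp [HopfData.regrade]
  · exact ⟨fun x v hv => (hP.grading.isHomog_of_regrade hH hdeg hv).1, fun _ _ => rfl⟩
  · rw [hmap, hmap', ← mul_coboundary_inv J, hJΦ]
    exact hM.twist hJinv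
  · rw [hmap]
    refine hdiag.regrade_twist (σ := σ) (fun g v => hH.yd.isHomog) fun g v hv hv0 hg => ⟨?_, ?_⟩
    · exact hσ ⟨v, hv, by rwa [hg]⟩
    · have := hEσ g v hv
      rw [hg] at this
      exact hMyd.isHomog this
  · rw [congrFun hmap i]
    exact isSimpleSubobject_regrade_twist_iff hrange (hVσ i)
      fun v hv => hH.yd.isHomog (hγ i v hv)
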